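/- Let $N\ge 1$, let $\tau_1,\dots,\tau_N$ be nonnegative integers, not all zero, let $p_1,\dots,p_N\in(0,1)$ and $\theta>0$. Consider the controlled Markov chain $Y(t)$, $t=0,1,2,\dots$, with finite state space $\mathbb Y=\prod_{n=1}^N\{0,1,\dots,\tau_n\}$ and control set $\{1,\dots,N\}$: if $Y(t)=x$ and the control is $U(t)=u$, then with probability $p_u$ the next state $y$ has $y_u=0$ and $y_n=\min(x_n+1,\tau_n)$ for $n\ne u$, and with probability $1-p_u$ it has $y_n=\min(x_n+1,\tau_n)$ for all $n$. For a history-dependent (possibly randomized) policy $\pi$ and $x\in\mathbb Y$ put $$V_T^\pi(x)=\mathrm E_\pi\Big[\exp\Big(\theta\sum_{t=0}^{T-1}\sum_{n=1}^N \mathbf 1\{Y_n(t)=\tau_n\}\Big)\,\Big|\,Y(0)=x\Big],\qquad J(\pi,x)=\limsup_{T\to\infty}\frac1{\theta T}\ln V_T^\pi(x).$$ A stationary policy is a map $f:\mathbb Y\to\{1,\dots,N\}$, applied as $U(t)=f(Y(t))$; it is optimal if $J(f,x)\le J(\pi,x)$ for all history-dependent policies $\pi$ and all $x\in\mathbb Y$.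 Let $L^f$ be the matrix on $\mathbb Y$ with entries $L^f_{x,y}=\exp\big(\theta\sum_n\mathbf 1\{x_n=\tau_n\}\big)\,\mathrm P[Y(t+1)=y\mid Y(t)=x,U(t)=f(x)]$, and let $\rho(L^f)$ be its spectral radius. With $\tau_{\max}=\max_n\tau_n$ and $p_{\max}=\max_n p_n$ put $$K=\big\lceil \tau_{\max}(1-p_{\max})^{-\tau_{\max}}\big\rceil,\qquad \theta_{\mathrm{th}}=\frac{\ln(K+1)-\ln K}{2N(K+1)}.$$ 1) If $0<\theta<\theta_{\mathrm{th}}$, then there is a stationary optimal policy. 2) If $0<\theta<\theta_{\mathrm{th}}$, then every stationary policy $f$ satisfies $J(f,x)=\frac1\theta\ln\rho(L^f)$ for all $x\in\mathbb Y$, so that a stationary optimal policy is found by comparing finitely many spectral radii. Moreover such a policy can be computed exactly in a finite number of steps: for all $N$ and $\tau_1,\dots,\tau_N$ there are a finite computation tree over the real numbers (its steps being the operations $+,-,\times,\div$, $\exp$, rational constants, and comparisons of two computed numbers) and a bound $S$, such that for all $p_1,\dots,p_N\in(0,1)$ and $0<\theta<\theta_{\mathrm{th}}$ the tree, on input $(p_1,\dots,p_N,\theta)$,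 outputs a stationary optimal policy after at most $S$ steps. -/

import Mathlib

namespace InterDelivery

/-! ### The controlled Markov chain (MDP-2) -/

/-- The state space `∏ n, {0, 1, …, τ n}`. -/
abbrev State {N : ℕ} (τ : Fin N → ℕ) : Type := (n : Fin N) → Fin (τ n + 1)

/-- `min (k + 1) m` as an element of `{0, …, m}`. -/
def tick {m : ℕ} (k : Fin (m + 1)) : Fin (m + 1) :=
  ⟨min (k.val + 1) m, Nat.lt_succ_of_le (min_le_right _ _)⟩

/-- The state that follows `x` when the transmission fails: `(x + 1) ∧ τ`. -/
def failState {N : ℕ} {τ : Fin N → ℕ} (x : State τ) : State τ := fun n => tick (x n)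

/-- The state that follows `x` when the transmission of client `u` succeeds: coordinate `u` is
reset to `0`, all others become `(x n + 1) ∧ τ n`. -/
def successState {N : ℕ} {τ : Fin N → ℕ} (u : Fin N) (x : State τ) : State τ :=
  fun n => if n = u then 0 else tick (x n)

/-- The transition probability `P[Y(t+1) = y | Y(t) = x, U(t) = u]`. -/
def transProb {N : ℕ} {τ : Fin N → ℕ} (p : Fin N → ℝ) (u : Fin N) (x y : State τ) : ℝ :=
  (if y = successState u x then p u else 0) + (if y = failState x then 1 - p u else 0)

/-- The one-slot cost: the number of clients `n` with `x n = τ n`. -/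
def slotCost {N : ℕ} {τ : Fin N → ℕ} (x : State τ) : ℝ :=
  ∑ n : Fin N, if (x n).val = τ n then 1 else 0

/-! ### Policies -/

/-- A history of length `t` after the initial state: entry `s` is the pair `(U(s), Y(s+1))`. -/
abbrev History {N : ℕ} (τ : Fin N → ℕ) (t : ℕ) : Type := Fin t → Fin N × State τ

/-- A history-dependent, possibly randomized, policy: `prob t x h u` is the probability of
choosing client `u` in slot `t` when `Y(0) = x` and the subsequent history is `h`. -/
structure Policy {N : ℕ} (τ : Fin N → ℕ) where
  prob : (t : ℕ) → State τ → History τ t → Fin N → ℝ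
  prob_nonneg : ∀ t x h u, 0 ≤ prob t x h u
  prob_sum : ∀ t x h, ∑ u : Fin N, prob t x h u = 1

/-- `Y(t)` for `t < T`, along the history `h` of length `T` that starts in `x`. -/
def stateAt {N : ℕ} {τ : Fin N → ℕ} {T : ℕ} (x : State τ) (h : History τ T) (t : Fin T) :
    State τ :=
  if t.val = 0 then x else (h ⟨t.val - 1, lt_of_le_of_lt (Nat.sub_le _ _) t.isLt⟩).2

/-- The first `t` entries of a history of length `T`. -/
def truncate {N : ℕ} {τ : Fin N → ℕ} {T : ℕ} (h : History τ T) (t : Fin T) : History τ t.val :=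
  fun s => h ⟨s.val, s.isLt.trans t.isLt⟩

/-- The probability, under `π` and given `Y(0) = x`, that the first `T` slots produce `h`. -/
def historyProb {N : ℕ} {τ : Fin N → ℕ} (p : Fin N → ℝ) (π : Policy τ) (x : State τ) {T : ℕ}
    (h : History τ T) : ℝ :=
  ∏ t : Fin T, π.prob t.val x (truncate h t) (h t).1 *
    transProb p (h t).1 (stateAt x h t) (h t).2

/-- `E_π [exp (θ ∑_{t < T} ∑_n 1{Y_n(t) = τ_n}) | Y(0) = x]`. -/
noncomputable def horizonCost {N : ℕ} {τ : Fin N → ℕ} (p : Fin N → ℝ) (θ : ℝ) (π : Policy τ)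
    (T : ℕ) (x : State τ) : ℝ :=
  ∑ h : History τ T, historyProb p π x h * Real.exp (θ * ∑ t : Fin T, slotCost (stateAt x h t))

/-- The risk-sensitive infinite-horizon average cost
`J(π, x) = limsup_T (1/θ) (1/T) ln V_T^π(x)`. -/
noncomputable def averageCost {N : ℕ} {τ : Fin N → ℕ} (p : Fin N → ℝ) (θ : ℝ) (π : Policy τ)
    (x : State τ) : ℝ :=
  Filter.limsup (fun T : ℕ => 1 / θ * (1 / (T : ℝ)) * Real.log (horizonCost p θ π T x))
    Filter.atTop

/-- The stationary policy `U(t) = f (Y(t))`. -/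
def stationary {N : ℕ} {τ : Fin N → ℕ} (f : State τ → Fin N) : Policy τ where
  prob t x h u :=
    if u = f (if ht : t = 0 then x else (h ⟨t - 1, Nat.sub_one_lt ht⟩).2) then 1 else 0
  prob_nonneg t x h u := by split_ifs <;> norm_num
  prob_sum t x h := by simp

/-- The stationary policy `f` is optimal: from every initial state its average cost is least among
all history-dependent policies. -/
def IsOptimal {N : ℕ} {τ : Fin N → ℕ} (p : Fin N → ℝ) (θ : ℝ) (f : State τ → Fin N) : Prop :=
  ∀ (π : Policy τ) (x : State τ), averageCost p θ (stationary f) x ≤ averageCost p θ π x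

/-- The dis-utility matrix `L^f`. -/
noncomputable def disutility {N : ℕ} {τ : Fin N → ℕ} (p : Fin N → ℝ) (θ : ℝ)
    (f : State τ → Fin N) : Matrix (State τ) (State τ) ℝ :=
  Matrix.of fun x y => Real.exp (θ * slotCost x) * transProb p (f x) x y

/-- The spectral radius of a real square matrix (over its complex eigenvalues). -/
noncomputable def specRadius {ι : Type} [Fintype ι] [DecidableEq ι] (A : Matrix ι ι ℝ) : ℝ :=
  (spectralRadius ℂ (A.map Complex.ofReal)).toReal

/-! ### The threshold for the risk parameter -/

/-- `τ_max`. -/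
def tauMax {N : ℕ} (τ : Fin N → ℕ) : ℕ := Finset.univ.sup τ

/-- `p_max`. -/
noncomputable def pMax {N : ℕ} (p : Fin N → ℝ) : ℝ := ⨆ n, p n

/-- `K = ⌈τ_max (1 - p_max)^(-τ_max)⌉`. -/
noncomputable def hitBound {N : ℕ} (τ : Fin N → ℕ) (p : Fin N → ℝ) : ℕ :=
  ⌈(tauMax τ : ℝ) * ((1 - pMax p) ^ tauMax τ)⁻¹⌉₊

/-- `θ_th = (ln (K + 1) - ln K) / (2 N (K + 1))`. -/
noncomputable def thetaTh {N : ℕ} (τ : Fin N → ℕ) (p : Fin N → ℝ) : ℝ :=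
  (Real.log ((hitBound τ p : ℝ) + 1) - Real.log (hitBound τ p : ℝ)) /
    (2 * (N : ℝ) * ((hitBound τ p : ℝ) + 1))

/-- Reliabilities in `(0, 1)` and a risk parameter `0 < θ < θ_th`. -/
def Admissible {N : ℕ} (τ : Fin N → ℕ) (p : Fin N → ℝ) (θ : ℝ) : Prop :=
  (∀ n, 0 < p n ∧ p n < 1) ∧ 0 < θ ∧ θ < thetaTh τ p

/-! ### Exact computation with real numbers -/

/-- The unit-cost operations on `n` real registers: rational constants, the four arithmetic
operations and the exponential function. -/
inductive Instr (n : ℕ) : Type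
  | const (q : ℚ)
  | add (i j : Fin n)
  | sub (i j : Fin n)
  | mul (i j : Fin n)
  | div (i j : Fin n)
  | exp (i : Fin n)

/-- The value of an operation. (Division by zero returns `0`; a program can test for it.) -/
noncomputable def Instr.eval {n : ℕ} (r : Fin n → ℝ) : Instr n → ℝ
  | .const q => (q : ℝ)
  | .add i j => r i + r j
  | .sub i j => r i - r j
  | .mul i j => r i * r j
  | .div i j => r i / r j
  | .exp i => Real.exp (r i)

/-- A computation tree over the reals, with `n` registers filled: it either stops with an output,
or writes the result of an operation to a new register, or compares two registers and branches.
The tree itself does not depend on the contents of the registers. -/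
inductive CompTree (α : Type) : ℕ → Type
  | output {n : ℕ} (a : α) : CompTree α n
  | compute {n : ℕ} (c : Instr n) (next : CompTree α (n + 1)) : CompTree α n
  | branch {n : ℕ} (i j : Fin n) (le gt : CompTree α n) : CompTree α n

/-- `t.Run r a s`: started with register contents `r`, the computation `t` stops with output `a`
after exactly `s` steps, each operation and each comparison being one step. -/
inductive CompTree.Run {α : Type} : {n : ℕ} → CompTree α n → (Fin n → ℝ) → α → ℕ → Prop
  | output {n : ℕ} (r : Fin n → ℝ) (a : α) : Run (CompTree.output a) r a 0
  | compute {n : ℕ} (r : Fin n → ℝ) (c : Instr n) (next : CompTree α (n + 1)) (a : α) (s : ℕ) :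
      Run next (Fin.snoc (α := fun _ => ℝ) r (c.eval r)) a s →
        Run (CompTree.compute c next) r a (s + 1)
  | branchLe {n : ℕ} (r : Fin n → ℝ) (i j : Fin n) (le gt : CompTree α n) (a : α) (s : ℕ) :
      r i ≤ r j → Run le r a s → Run (CompTree.branch i j le gt) r a (s + 1)
  | branchGt {n : ℕ} (r : Fin n → ℝ) (i j : Fin n) (le gt : CompTree α n) (a : α) (s : ℕ) :
      r j < r i → Run gt r a s → Run (CompTree.branch i j le gt) r a (s + 1)

/-- The real input data `(p_1, …, p_N, θ)`. -/
def inputData {N : ℕ} (p : Fin N → ℝ) (θ : ℝ) : Fin (N + 1) → ℝ :=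
  Fin.snoc (α := fun _ => ℝ) p θ

end InterDelivery

namespace InterDelivery

open Polynomial SignType

/-! ### Corresponding positions with respect to two matched finite sets of reals -/

/-! Let `z = dueState τ`. Whatever the controls, at most `τ_max` failures in a row lead to `z`.
Hence a function `w` of `slack`, zero at `z` and at most `K`, drops on average by at least one per
slot off `z` (`drift`). The threshold gives `exp (θN) * K < K + 1`, so `exp (θN) * (w - 1) < w`: off
`z`, `w` is a strict supersolution of every `L^f` killed at `z`. The resulting minimum principle
(`Admissible.minPrinciple`) replaces irreducibility, which `L^f` need not have.

Solving the killed equation at level `l ≥ 1` and adjusting `l` by the intermediate value theorem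
produces a positive eigenvector of `L^f` with value 1 at `z`. Its eigenvalue is the spectral radius,
and squeezing the constant terminal reward between multiples of the eigenvector gives the average
cost. For optimality, let `f` minimize the eigenvalue and then the sum of the eigenvector. Greedy
improvement with respect to that eigenvector can lower neither quantity, so the eigenvector solves
the multiplicative optimality equation. Iterating this equation bounds the cost of every
history-dependent policy from below.

For the computation, the entries of `L^f` are integer polynomials in `p` and `exp θ`, and `f` is
optimal iff the largest real root of its characteristic polynomial is least
(`Admissible.isOptimal_iff`). No root has to be computed. By `exists_finite_sameDiagram` the order
of the roots depends only on the signs of finitely many integer polynomials in `p` and `exp θ`; a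
tree branches on these signs, and one policy serves each sign pattern. The elimination rests on
differentiation and pseudo-division: between consecutive roots of its derivative a polynomial is
strictly monotone, so its signs are governed by those at the points of a diagram, where they are
signs of remainders. -/

/-- `x` lies relative to the first coordinates of `D` as `y` lies relative to the second ones. -/
def SamePos (D : Set (ℝ × ℝ)) (x y : ℝ) : Prop :=
  ∀ d ∈ D, (x < d.1 ↔ y < d.2) ∧ (d.1 < x ↔ d.2 < y)

/-- `D` is the graph of an order isomorphism between two finite sets of reals. -/
structure IsMatching (D : Set (ℝ × ℝ)) : Prop where
  finite : D.Finite
  samePos : ∀ d ∈ D, SamePos D d.1 d.2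

namespace SamePos

variable {D : Set (ℝ × ℝ)} {x y y₁ y₂ : ℝ}

theorem swap (h : SamePos D x y) : SamePos (Prod.swap ⁻¹' D) y x := fun d hd =>
  ⟨(h d.swap hd).1.symm, (h d.swap hd).2.symm⟩

theorem of_swap (h : SamePos (Prod.swap ⁻¹' D) y x) : SamePos D x y := fun d hd =>
  ⟨(h d.swap hd).1.symm, (h d.swap hd).2.symm⟩

theorem mono {E : Set (ℝ × ℝ)} (hE : E ⊆ D) (h : SamePos D x y) : SamePos E x y :=
  fun d hd => h d (hE hd)

theorem eq_iff (h : SamePos D x y) {d : ℝ × ℝ} (hd : d ∈ D) : x = d.1 ↔ y = d.2 := by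
  have := h d hd
  constructor <;> intro e
  · exact le_antisymm (not_lt.1 fun h' => by linarith [this.2.2 h'])
      (not_lt.1 fun h' => by linarith [this.1.2 h'])
  · exact le_antisymm (not_lt.1 fun h' => by linarith [this.2.1 h'])
      (not_lt.1 fun h' => by linarith [this.1.1 h'])

/-- Each matched pair imposes an order condition on `y`, so a cell is an interval. This keeps roots
found by the intermediate value theorem inside their cell. -/
theorem convex (h₁ : SamePos D x y₁) (h₂ : SamePos D x y₂) (hy : y ∈ Set.uIcc y₁ y₂) :
    SamePos D x y := by
  intro d hd
  have e₁ := h₁ d hd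
  have e₂ := h₂ d hd
  rw [Set.mem_uIcc] at hy
  grind

/-- The relation pairs whole cells on the left with whole cells on the right, so three corners of a
rectangle force the fourth. -/
theorem of_cell {x₁ : ℝ} (h : SamePos D x y) (h₁ : SamePos D x₁ y) (h₂ : SamePos D x y₁) :
    SamePos D x₁ y₁ := by
  intro d hd
  have := h d hd
  have := h₁ d hd
  have := h₂ d hd
  tauto

theorem convex_left {x₁ x₂ : ℝ} (h₁ : SamePos D x₁ y) (h₂ : SamePos D x₂ y)
    (hx : x ∈ Set.uIcc x₁ x₂) : SamePos D x y :=
  (h₁.swap.convex h₂.swap hx).of_swap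

theorem reflect (h : SamePos D x y) :
    SamePos ((fun d => -d) ⁻¹' D) (-x) (-y) := fun d hd => by
  have := h (-d) hd
  simp only [Prod.fst_neg, Prod.snd_neg] at this
  constructor
  · rw [neg_lt, this.2, neg_lt]
  · rw [lt_neg, this.1, lt_neg]

theorem of_reflect (h : SamePos ((fun d => -d) ⁻¹' D) (-x) (-y)) : SamePos D x y := by
  have := h.reflect
  simpa [Set.preimage_preimage] using this

end SamePos

namespace IsMatching

variable {D : Set (ℝ × ℝ)}

theorem swap (h : IsMatching D) : IsMatching (Prod.swap ⁻¹' D) where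
  finite := h.finite.preimage Prod.swap_injective.injOn
  samePos d hd := (h.samePos d.swap hd).swap

theorem reflect (h : IsMatching D) : IsMatching ((fun d => -d) ⁻¹' D) where
  finite := h.finite.preimage neg_injective.injOn
  samePos d hd := by simpa using (h.samePos (-d) hd).reflect

theorem mono {E : Set (ℝ × ℝ)} (h : IsMatching D) (hE : E ⊆ D) : IsMatching E where
  finite := h.finite.subset hE
  samePos d hd := (h.samePos d (hE hd)).mono hE

/-- An unmatched `x` splits the finite set `D` into a lower and an upper part. The matching
preserves this order, and density of the reals leaves room between the second coordinates. -/
theorem exists_samePos (h : IsMatching D) (x : ℝ) : ∃ y, SamePos D x y := by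
  by_cases hx : ∃ d ∈ D, d.1 = x
  · obtain ⟨d, hd, rfl⟩ := hx
    exact ⟨d.2, h.samePos d hd⟩
  push Not at hx
  obtain ⟨y, hy₁, hy₂⟩ := Order.exists_between_finsets
    ((h.finite.subset (Set.sep_subset D fun d => d.1 < x)).toFinset.image Prod.snd)
    ((h.finite.subset (Set.sep_subset D fun d => x < d.1)).toFinset.image Prod.snd) (by
      simp only [Finset.mem_image, Set.Finite.mem_toFinset, Set.mem_ofPred_eq]
      rintro _ ⟨d, ⟨hd, hdx⟩, rfl⟩ _ ⟨e, ⟨he, hex⟩, rfl⟩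
      exact ((h.samePos d hd) e he).1.1 (hdx.trans hex))
  simp only [Finset.mem_image, Set.Finite.mem_toFinset, Set.mem_ofPred_eq] at hy₁ hy₂
  refine ⟨y, fun d hd => ?_⟩
  rcases lt_or_gt_of_ne (hx d hd) with h' | h'
  · have := hy₁ _ ⟨d, ⟨hd, h'⟩, rfl⟩
    exact ⟨⟨fun h => by linarith, fun h => by linarith⟩, ⟨fun _ => this, fun _ => h'⟩⟩
  · have := hy₂ _ ⟨d, ⟨hd, h'⟩, rfl⟩
    exact ⟨⟨fun _ => this, fun _ => h'⟩, ⟨fun h => by linarith, fun h => by linarith⟩⟩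

theorem exists_samePos' (h : IsMatching D) (y : ℝ) : ∃ x, SamePos D x y :=
  let ⟨x, hx⟩ := h.swap.exists_samePos y
  ⟨x, hx.of_swap⟩

/-- Cells that do not consist of a matched point are open. -/
theorem eventually_samePos (h : IsMatching D) {x y : ℝ} (hxy : SamePos D x y)
    (hx : ∀ d ∈ D, d.1 ≠ x) : ∀ᶠ x₁ in nhds x, SamePos D x₁ y := by
  refine (Filter.eventually_all_finite h.finite).2 fun d hd => ?_
  rcases lt_or_gt_of_ne (hx d hd) with h' | h'
  · filter_upwards [lt_mem_nhds h'] with x₁ hx₁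
    have := hxy d hd
    grind
  · filter_upwards [gt_mem_nhds h'] with x₁ hx₁
    have := hxy d hd
    grind

end IsMatching

theorem exists_root_uIcc {Q : ℝ[X]} {y₁ y₂ : ℝ} (h : sign (Q.eval y₁) ≠ sign (Q.eval y₂)) :
    ∃ y ∈ Set.uIcc y₁ y₂, Q.eval y = 0 := by
  have hc : ContinuousOn (fun y => Q.eval y) (Set.uIcc y₁ y₂) := Q.continuous.continuousOn
  have : (0 : ℝ) ∈ Set.uIcc (Q.eval y₁) (Q.eval y₂) := by
    rw [Set.mem_uIcc]
    by_contra hn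
    push Not at hn
    apply h
    rcases lt_trichotomy (Q.eval y₁) 0 with h₁ | h₁ | h₁
    · have : Q.eval y₂ < 0 := by grind
      rw [sign_neg h₁, sign_neg this]
    · grind
    · have : 0 < Q.eval y₂ := by grind
      rw [sign_pos h₁, sign_pos this]
  obtain ⟨y, hy, hy'⟩ := intermediate_value_uIcc hc this
  exact ⟨y, hy, hy'⟩

theorem exists_derivative_mul_sub (P : ℝ[X]) {x₁ x₂ : ℝ} (h : x₁ < x₂) :
    ∃ c ∈ Set.Ioo x₁ x₂, P.derivative.eval c * (x₂ - x₁) = P.eval x₂ - P.eval x₁ := by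
  obtain ⟨c, hc, hc'⟩ := exists_deriv_eq_slope (fun x => P.eval x) h P.continuous.continuousOn
    P.differentiable.differentiableOn
  refine ⟨c, hc, ?_⟩
  rw [Polynomial.deriv] at hc'
  rw [hc', div_mul_cancel₀ _ (sub_ne_zero.2 h.ne')]

/-! ### Adding a polynomial whose derivative is already under control -/

/-- The polynomials `P` and `Q` have the same signs at matched points, and their derivatives have
the same signs at corresponding positions and vanish at matched points only. -/
structure Liftable (D : Set (ℝ × ℝ)) (P Q : ℝ[X]) : Prop where
  matching : IsMatching D
  natDegree_left : P.natDegree ≠ 0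
  natDegree_right : Q.natDegree ≠ 0
  sign_eq : ∀ d ∈ D, sign (P.eval d.1) = sign (Q.eval d.2)
  sign_derivative : ∀ x y, SamePos D x y →
    sign (P.derivative.eval x) = sign (Q.derivative.eval y)
  zero_derivative : ∀ x, P.derivative.eval x = 0 → ∃ d ∈ D, d.1 = x

namespace Liftable

variable {D : Set (ℝ × ℝ)} {P Q : ℝ[X]}

/-- The symmetries `swap`, `neg` and `reflect` reduce the case distinctions below to a positive
value or a root with positive derivative, and transfer from `P` to `Q` to transfer in both
directions. -/
theorem swap (h : Liftable D P Q) : Liftable (Prod.swap ⁻¹' D) Q P where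
  matching := h.matching.swap
  natDegree_left := h.natDegree_right
  natDegree_right := h.natDegree_left
  sign_eq d hd := (h.sign_eq d.swap hd).symm
  sign_derivative x y hxy := (h.sign_derivative y x hxy.of_swap).symm
  zero_derivative y hy := by
    obtain ⟨x, hx⟩ := h.matching.exists_samePos' y
    obtain ⟨d, hd, e⟩ := h.zero_derivative x (by
      rw [← sign_eq_zero_iff, h.sign_derivative x y hx, hy, sign_zero])
    exact ⟨d.swap, by simpa using hd, ((hx.eq_iff hd).1 e.symm).symm⟩

theorem neg (h : Liftable D P Q) : Liftable D (-P) (-Q) where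
  matching := h.matching
  natDegree_left := by simpa using h.natDegree_left
  natDegree_right := by simpa using h.natDegree_right
  sign_eq d hd := by simp [Left.sign_neg, h.sign_eq d hd]
  sign_derivative x y hxy := by simp [Left.sign_neg, h.sign_derivative x y hxy]
  zero_derivative x hx := h.zero_derivative x (by simpa using hx)

theorem reflect (h : Liftable D P Q) :
    Liftable ((fun d => -d) ⁻¹' D) (P.comp (-X)) (Q.comp (-X)) where
  matching := h.matching.reflect
  natDegree_left := by simpa [natDegree_comp] using h.natDegree_left
  natDegree_right := by simpa [natDegree_comp] using h.natDegree_right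
  sign_eq d hd := by simpa using h.sign_eq (-d) hd
  sign_derivative x y hxy := by
    have := h.sign_derivative (-x) (-y) (SamePos.of_reflect (by simpa using hxy))
    simp [derivative_comp, Left.sign_neg, this]
  zero_derivative x hx := by
    obtain ⟨d, hd, e⟩ := h.zero_derivative (-x) (by simpa [derivative_comp] using hx)
    exact ⟨-d, by simpa using hd, by simp [e]⟩

/-- To the right of `x`, `P` grows up to the end of the cell. If that end is a matched point, `P`
and therefore `Q` is positive there, and so is `Q` just before it. If the cell is unbounded, an
increasing `Q` that stays nonpositive would be bounded, hence constant. -/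
theorem exists_pos_of_derivative_pos (h : Liftable D P Q) {x : ℝ} (hx : 0 < P.eval x)
    (hx' : 0 < P.derivative.eval x) : ∃ y, SamePos D x y ∧ 0 < Q.eval y := by
  obtain ⟨y₀, hy₀⟩ := h.matching.exists_samePos x
  have hder (x₁ y₁ : ℝ) (h₁ : SamePos D x₁ y₀) (h₂ : SamePos D x y₁) :
      0 < P.derivative.eval x₁ ∧ 0 < Q.derivative.eval y₁ := by
    rw [← sign_eq_one_iff, ← sign_eq_one_iff (a := Q.derivative.eval y₁),
      h.sign_derivative _ _ h₁, ← h.sign_derivative _ _ hy₀, ← h.sign_derivative _ _ h₂,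
      sign_eq_one_iff]
    exact ⟨hx', hx'⟩
  by_cases hxD : ∃ d ∈ D, d.1 = x
  · obtain ⟨d, hd, rfl⟩ := hxD
    refine ⟨d.2, h.matching.samePos d hd, ?_⟩
    rwa [← sign_eq_one_iff, ← h.sign_eq d hd, sign_eq_one_iff]
  push Not at hxD
  by_contra! hneg
  by_cases hr : ∃ d ∈ D, x < d.1
  · obtain ⟨d, ⟨hd, hxd⟩, hmin⟩ := Set.exists_min_image {d ∈ D | x < d.1} Prod.fst
      (h.matching.finite.subset (Set.sep_subset _ _)) hr
    obtain ⟨c, hc, hc'⟩ := exists_derivative_mul_sub P hxd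
    have hcell : ∀ y, y₀ ≤ y → y < d.2 → SamePos D x y := by
      intro y hy hyd e he
      have e₀ := hy₀ e he
      refine ⟨⟨fun hxe => ?_, fun hye => e₀.1.2 (hy.trans_lt hye)⟩,
        ⟨fun hex => (e₀.2.1 hex).trans_le hy, fun hey => ?_⟩⟩
      · refine hyd.trans_le (not_lt.1 fun hlt => ?_)
        exact (hmin e ⟨he, hxe⟩).not_gt (((h.matching.samePos e he) d hd).1.2 hlt)
      · by_contra hle
        have hxe : x ≤ e.1 := not_lt.1 hle
        have hed : e.1 < d.1 := ((h.matching.samePos e he) d hd).1.2 (hey.trans hyd)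
        exact (hmin e ⟨he, hxe.lt_of_ne (hxD e he).symm⟩).not_gt hed
    have hcx : SamePos D c y₀ := by
      intro e he
      have e₀ := hy₀ e he
      rw [← e₀.1, ← e₀.2]
      refine ⟨⟨fun h' => hc.1.trans h', fun h' => hc.2.trans_le (hmin e ⟨he, h'⟩)⟩,
        ⟨fun h' => ?_, fun h' => h'.trans hc.1⟩⟩
      by_contra hle
      exact absurd (hmin e ⟨he, (not_lt.1 hle).lt_of_ne (hxD e he).symm⟩)
        (not_le.2 (h'.trans hc.2))
    have hPd : 0 < P.eval d.1 := by
      have := (hder c y₀ hcx hy₀).1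
      nlinarith [mul_pos this (sub_pos.2 hxd)]
    have hQd : 0 < Q.eval d.2 := by
      rw [← sign_eq_one_iff, ← h.sign_eq d hd, sign_eq_one_iff]
      exact hPd
    have hy0d : y₀ < d.2 := (hy₀ d hd).1.1 hxd
    have hev : ∀ᶠ y in nhdsWithin d.2 (Set.Iio d.2), Q.eval y ≤ 0 := by
      filter_upwards [Ioo_mem_nhdsLT hy0d] with y hy
      exact hneg y (hcell y hy.1.le hy.2)
    have := le_of_tendsto (Q.continuous.continuousAt.tendsto.mono_left nhdsWithin_le_nhds) hev
    linarith
  · push Not at hr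
    have hcell : ∀ y, y₀ ≤ y → SamePos D x y := by
      intro y hy e he
      have e₀ := hy₀ e he
      have hex := hr e he
      have hey : e.2 ≤ y₀ := not_lt.1 fun h' => hex.not_gt (e₀.1.2 h')
      refine ⟨⟨fun h' => by linarith, fun h' => by linarith⟩,
        ⟨fun h' => (e₀.2.1 h').trans_le hy, fun _ => hex.lt_of_ne (hxD e he)⟩⟩
    have hb : Filter.IsBoundedUnder (· ≤ ·) Filter.atTop fun y => |Q.eval y| := by
      refine ⟨|Q.eval y₀|, ?_⟩
      rw [Filter.eventually_map]
      filter_upwards [Filter.eventually_gt_atTop y₀] with y hy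
      obtain ⟨c, hc, hc'⟩ := exists_derivative_mul_sub Q hy
      have hpos := (hder x c hy₀ (hcell c hc.1.le)).2
      have h₁ := hneg y (hcell y hy.le)
      have h₂ := mul_pos hpos (sub_pos.2 hy)
      rw [abs_of_nonpos h₁, abs_of_nonpos (hneg y₀ hy₀)]
      linarith
    exact h.natDegree_right (natDegree_eq_zero_iff_degree_le_zero.2
      ((isBoundedUnder_abs_atTop_iff Q).1 hb))

theorem exists_sign_eq_of_pos (h : Liftable D P Q) {x : ℝ} (hx : 0 < P.eval x) :
    ∃ y, SamePos D x y ∧ 0 < Q.eval y := by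
  rcases lt_trichotomy (P.derivative.eval x) 0 with h' | h' | h'
  · obtain ⟨y, hy, hy'⟩ := h.reflect.exists_pos_of_derivative_pos (x := -x) (by simpa using hx)
      (by simpa [derivative_comp] using h')
    exact ⟨-y, SamePos.of_reflect (by simpa using hy), by simpa using hy'⟩
  · obtain ⟨d, hd, rfl⟩ := h.zero_derivative x h'
    refine ⟨d.2, h.matching.samePos d hd, ?_⟩
    rwa [← sign_eq_one_iff, ← h.sign_eq d hd, sign_eq_one_iff]
  · exact h.exists_pos_of_derivative_pos hx h'

theorem exists_sign_eq_of_neg (h : Liftable D P Q) {x : ℝ} (hx : P.eval x < 0) :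
    ∃ y, SamePos D x y ∧ Q.eval y < 0 := by
  obtain ⟨y, hy, hy'⟩ := h.neg.exists_sign_eq_of_pos (x := x) (by simpa using hx)
  exact ⟨y, hy, by simpa using hy'⟩

/-- Near a simple root in an open cell, `P` takes both signs. Both transfer to `Q` on the
corresponding cell, where the intermediate value theorem applies. -/
theorem exists_root_of_derivative_pos (h : Liftable D P Q) {x : ℝ} (hx : P.eval x = 0)
    (hx' : 0 < P.derivative.eval x) (hxD : ∀ d ∈ D, d.1 ≠ x) :
    ∃ y, SamePos D x y ∧ Q.eval y = 0 := by
  obtain ⟨y₀, hy₀⟩ := h.matching.exists_samePos x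
  have hev := (h.matching.eventually_samePos hy₀ hxD).and
    (eventually_nhdsWithin_sign_eq_of_deriv_pos (f := fun x => P.eval x)
      (by simpa [Polynomial.deriv] using hx') hx)
  obtain ⟨x₂, ⟨h₂, e₂⟩, hlt₂⟩ := (hev.filter_mono nhdsWithin_le_nhds |>.and
    (self_mem_nhdsWithin : Set.Ioi x ∈ nhdsWithin x (Set.Ioi x))).exists
  obtain ⟨x₁, ⟨h₁, e₁⟩, hlt₁⟩ := (hev.filter_mono nhdsWithin_le_nhds |>.and
    (self_mem_nhdsWithin : Set.Iio x ∈ nhdsWithin x (Set.Iio x))).exists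
  rw [sign_pos (sub_pos.2 hlt₂), sign_eq_one_iff] at e₂
  rw [_root_.sign_neg (sub_neg.2 hlt₁), sign_eq_neg_one_iff] at e₁
  obtain ⟨y₂, hy₂, p₂⟩ := h.exists_sign_eq_of_pos e₂
  obtain ⟨y₁, hy₁, p₁⟩ := h.exists_sign_eq_of_neg e₁
  obtain ⟨y, hy, hy'⟩ := exists_root_uIcc (Q := Q) (y₁ := y₁) (y₂ := y₂)
    (by rw [sign_pos p₂, _root_.sign_neg p₁]; decide)
  exact ⟨y, (h₁.of_cell hy₀ hy₁).convex (h₂.of_cell hy₀ hy₂) hy, hy'⟩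

theorem exists_root (h : Liftable D P Q) {x : ℝ} (hx : P.eval x = 0) :
    ∃ y, SamePos D x y ∧ Q.eval y = 0 := by
  by_cases hxD : ∃ d ∈ D, d.1 = x
  · obtain ⟨d, hd, rfl⟩ := hxD
    refine ⟨d.2, h.matching.samePos d hd, ?_⟩
    rwa [← sign_eq_zero_iff, ← h.sign_eq d hd, sign_eq_zero_iff]
  push Not at hxD
  rcases lt_trichotomy (P.derivative.eval x) 0 with h' | h' | h'
  · obtain ⟨y, hy, hy'⟩ := h.neg.exists_root_of_derivative_pos (x := x) (by simpa using hx)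
      (by simpa using h') hxD
    exact ⟨y, hy, by simpa using hy'⟩
  · obtain ⟨d, hd, e⟩ := h.zero_derivative x h'
    exact absurd e (hxD d hd)
  · exact h.exists_root_of_derivative_pos hx h' hxD

theorem exists_sign_eq (h : Liftable D P Q) (x : ℝ) :
    ∃ y, SamePos D x y ∧ sign (P.eval x) = sign (Q.eval y) := by
  rcases lt_trichotomy (P.eval x) 0 with h' | h' | h'
  · obtain ⟨y, hy, hy'⟩ := h.exists_sign_eq_of_neg h'
    exact ⟨y, hy, by rw [_root_.sign_neg h', _root_.sign_neg hy']⟩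
  · obtain ⟨y, hy, hy'⟩ := h.exists_root h'
    exact ⟨y, hy, by rw [h', hy']⟩
  · obtain ⟨y, hy, hy'⟩ := h.exists_sign_eq_of_pos h'
    exact ⟨y, hy, by rw [sign_pos h', sign_pos hy']⟩

/-- By Rolle, two roots in one cell would enclose a zero of the derivative, which is a matched point
and separates cells. -/
theorem root_unique (h : Liftable D P Q) {x₁ x₂ y : ℝ} (h₁ : SamePos D x₁ y)
    (h₂ : SamePos D x₂ y) (e₁ : P.eval x₁ = 0) (e₂ : P.eval x₂ = 0) : x₁ = x₂ := by
  wlog hlt : x₁ < x₂ generalizing x₁ x₂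
  · rcases (not_lt.1 hlt).lt_or_eq with h' | h'
    · exact (this h₂ h₁ e₂ e₁ h').symm
    · exact h'.symm
  obtain ⟨c, hc, hc'⟩ := exists_derivative_mul_sub P hlt
  rw [e₁, e₂, sub_zero, mul_eq_zero, or_iff_left (sub_pos.2 hlt).ne'] at hc'
  obtain ⟨d, hd, rfl⟩ := h.zero_derivative c hc'
  have := (h₁ d hd).2.2 ((h₂ d hd).2.1 hc.2)
  linarith [hc.1]

/-- The matched points together with the pairs of corresponding roots. -/
def rootExtension (D : Set (ℝ × ℝ)) (P Q : ℝ[X]) : Set (ℝ × ℝ) :=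
  D ∪ {d | SamePos D d.1 d.2 ∧ P.eval d.1 = 0 ∧ Q.eval d.2 = 0}

theorem lt_of_lt (h : Liftable D P Q) {d e : ℝ × ℝ} (hd : d ∈ rootExtension D P Q)
    (he : e ∈ rootExtension D P Q) (hlt : d.1 < e.1) : d.2 < e.2 := by
  rcases hd with hd | ⟨hd, d₁, d₂⟩
  · rcases he with he | ⟨he, -⟩
    · exact (h.matching.samePos d hd e he).1.1 hlt
    · exact (he d hd).2.1 hlt
  rcases he with he | ⟨he, e₁, e₂⟩
  · exact (hd e he).1.1 hlt
  by_contra hle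
  have hle : e.2 ≤ d.2 := not_lt.1 hle
  -- Root pairs in opposite orders squeeze `d.1` and `e.1` into a single cell, where the root is
  -- unique.
  refine hlt.ne (h.root_unique (y := e.2) (fun f hf => ?_) he d₁ e₁)
  have := hd f hf
  have := he f hf
  grind

theorem rootExtension_swap :
    Prod.swap ⁻¹' rootExtension D P Q = rootExtension (Prod.swap ⁻¹' D) Q P := by
  ext d
  constructor
  · rintro (hd | ⟨hd, h₁, h₂⟩)
    · exact Or.inl hd
    · exact Or.inr ⟨hd.swap, h₂, h₁⟩
  · rintro (hd | ⟨hd, h₁, h₂⟩)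
    · exact Or.inl hd
    · exact Or.inr ⟨hd.of_swap, h₂, h₁⟩

theorem isMatching_rootExtension (h : Liftable D P Q) :
    IsMatching (rootExtension D P Q) where
  finite := by
    have hP : P ≠ 0 := by rintro rfl; simpa using h.natDegree_left
    have hQ : Q ≠ 0 := by rintro rfl; simpa using h.natDegree_right
    refine h.matching.finite.union (((P.rootSet_finite ℝ).prod (Q.rootSet_finite ℝ)).subset ?_)
    rintro d ⟨-, h₁, h₂⟩
    simp [mem_rootSet, hP, hQ, h₁, h₂]
  samePos d hd e he := by
    have key : ∀ d ∈ rootExtension D P Q, ∀ e ∈ rootExtension D P Q, d.1 < e.1 ↔ d.2 < e.2 := by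
      intro d hd e he
      refine ⟨h.lt_of_lt hd he, fun hlt => ?_⟩
      refine h.swap.lt_of_lt (d := d.swap) (e := e.swap) ?_ ?_ hlt <;>
        rw [← rootExtension_swap] <;> simpa
    exact ⟨key d hd e he, key e he d hd⟩

/-- All points lie in one pair of cells, on which the derivatives have a common sign `s`. To the
left of its root `P` has sign `-s`, to the right of its root `Q` has sign `s`; equality forces both
to be zero. -/
theorem eq_zero_of_lt_of_lt (h : Liftable D P Q) {x y ξ η : ℝ} (hxy : SamePos D x y)
    (hξη : SamePos D ξ η) (hxη : SamePos D x η) (hξ : P.eval ξ = 0) (hη : Q.eval η = 0)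
    (h₁ : x < ξ) (h₂ : η < y) (hs : sign (P.eval x) = sign (Q.eval y)) : P.eval x = 0 := by
  obtain ⟨c, hc, hc'⟩ := exists_derivative_mul_sub P h₁
  obtain ⟨e, he, he'⟩ := exists_derivative_mul_sub Q h₂
  have hce : SamePos D c e := by
    have i₁ : SamePos D c η := hxη.convex_left hξη (Set.mem_uIcc_of_le hc.1.le hc.2.le)
    have i₂ : SamePos D x e := hxη.convex hxy (Set.mem_uIcc_of_le he.1.le he.2.le)
    exact hxη.of_cell i₁ i₂
  have := h.sign_derivative c e hce
  have s₁ : sign (P.derivative.eval c) = sign (-P.eval x) := by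
    rw [← zero_sub, ← hξ, ← hc', sign_mul, sign_pos (sub_pos.2 h₁), mul_one]
  have s₂ : sign (Q.derivative.eval e) = sign (Q.eval y) := by
    rw [← sub_zero (Q.eval y), ← hη, ← he', sign_mul, sign_pos (sub_pos.2 h₂), mul_one]
  rw [s₁, s₂, ← hs, Left.sign_neg] at this
  rw [← sign_eq_zero_iff]
  revert this
  generalize sign (P.eval x) = s
  revert s
  decide

/-- Some `y₁` in the `D`-cell of `x` has the right sign. If `y` had another one, a root `η` of `Q`
would lie between `y₁` and `y`. Its partner `ξ` lies on the same side of `x` as `η` of `y`, so `x`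
and `y₁` are on opposite sides of the roots, against `eq_zero_of_lt_of_lt`. -/
theorem sign_eq_of_samePos (h : Liftable D P Q) {x y : ℝ}
    (hxy : SamePos (rootExtension D P Q) x y) : sign (P.eval x) = sign (Q.eval y) := by
  have hxy' : SamePos D x y := hxy.mono Set.subset_union_left
  obtain ⟨y₁, hy₁, hs⟩ := h.exists_sign_eq x
  by_contra hne
  rw [hs] at hne
  obtain ⟨η, hη, hη0⟩ := exists_root_uIcc hne
  have hxη := hy₁.convex hxy' hη
  obtain ⟨ξ, hξ, hξ0⟩ := h.swap.exists_root hη0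
  have hξη := hξ.of_swap
  have hmem : (ξ, η) ∈ rootExtension D P Q := Or.inr ⟨hξη, hξ0, hη0⟩
  have hpos := hxy _ hmem
  have heq := hxy.eq_iff hmem
  simp only at hpos heq
  have hQ₁ : Q.eval y₁ ≠ 0 := by
    intro h0
    have hx0 : P.eval x = 0 := by rwa [h0, sign_zero, sign_eq_zero_iff] at hs
    have := heq.1 (h.root_unique hxη hξη hx0 hξ0)
    exact hne (by rw [h0, this, hη0])
  have hP : P.eval x ≠ 0 := fun h0 => hQ₁ (by rwa [h0, sign_zero, eq_comm, sign_eq_zero_iff] at hs)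
  have hy₁η : y₁ ≠ η := fun e => hQ₁ (e ▸ hη0)
  have hyη : y ≠ η := fun e => hP (heq.2 e ▸ hξ0)
  rw [Set.mem_uIcc] at hη
  rcases lt_or_gt_of_ne hyη with hlt | hlt
  · refine hP (h.eq_zero_of_lt_of_lt hy₁ hξη hxη hξ0 hη0 (hpos.1.2 hlt) ?_ hs)
    rcases hη with hη | hη
    · linarith [hη.2]
    · exact hη.2.lt_of_ne hy₁η.symm
  · refine hQ₁ (h.swap.eq_zero_of_lt_of_lt hy₁.swap hξη.swap ?_ hη0 hξ0 ?_ (hpos.2.2 hlt) hs.symm)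
    · exact ((hxη.of_cell hξη hy₁)).swap
    · rcases hη with hη | hη
      · exact hη.1.lt_of_ne hy₁η
      · linarith [hη.1]

end Liftable
end InterDelivery

namespace InterDelivery

open Polynomial SignType

/-! ### Sign diagrams of parametrized polynomials -/

section SignDiagram

variable {A : Type*} [CommRing A]

/-- The matched points of `D` separate the sign changes of the specializations of the members
of `F` under `a` and `b`. -/
def IsDiagram (a b : A →+* ℝ) (F : Set A[X]) (D : Set (ℝ × ℝ)) : Prop :=
  IsMatching D ∧ ∀ P ∈ F, ∀ x y, SamePos D x y →
    sign ((P.map a).eval x) = sign ((P.map b).eval y)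

/-- The specializations of the members of `F` under `a` and `b` have the same sign diagram. -/
def SameDiagram (a b : A →+* ℝ) (F : Set A[X]) : Prop := ∃ D, IsDiagram a b F D

variable {a b : A →+* ℝ} {F : Set A[X]} {D : Set (ℝ × ℝ)}

/-- An unmatched root would lie in an open cell, on which the sign is constantly zero: too many
roots for a nonzero polynomial. -/
theorem IsDiagram.exists_fst_eq (h : IsDiagram a b F D) {P : A[X]} (hP : P ∈ F)
    (h0 : P.map a ≠ 0) {x : ℝ} (hx : (P.map a).eval x = 0) : ∃ d ∈ D, d.1 = x := by
  by_contra! hxD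
  obtain ⟨y, hy⟩ := h.1.exists_samePos x
  have hev : ∀ᶠ x₁ in nhds x, (P.map a).eval x₁ = 0 := by
    filter_upwards [h.1.eventually_samePos hy hxD] with x₁ hx₁
    rw [← sign_eq_zero_iff, h.2 P hP x₁ y hx₁, ← h.2 P hP x y hy, hx, sign_zero]
  refine h0 (eq_zero_of_infinite_isRoot _ (Set.Infinite.mono ?_ (infinite_of_mem_nhds x hev)))
  intro x₁ hx₁
  exact hx₁

/-- Only roots of the given polynomials are needed as matched points. -/
theorem IsDiagram.restrict (h : IsDiagram a b F D) :
    IsDiagram a b F {d ∈ D | ∃ Q ∈ F, Q.map a ≠ 0 ∧ (Q.map a).eval d.1 = 0} := by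
  have hsub : {d ∈ D | ∃ Q ∈ F, Q.map a ≠ 0 ∧ (Q.map a).eval d.1 = 0} ⊆ D := Set.sep_subset _ _
  refine ⟨h.1.mono hsub, fun Q hQ x y hxy => ?_⟩
  obtain ⟨y₁, hy₁⟩ := h.1.exists_samePos x
  rw [h.2 Q hQ x y₁ hy₁]
  by_contra hne
  -- A sign change inside a merged cell passes through a root of `Q.map b`. Its partner is a root of
  -- `Q.map a`, hence a matched point that was retained and cannot lie inside the cell.
  obtain ⟨η, hη, hη0⟩ := exists_root_uIcc hne
  obtain ⟨ξ, hξ⟩ := h.1.exists_samePos' η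
  have hξ0 : (Q.map a).eval ξ = 0 := by
    rw [← sign_eq_zero_iff, h.2 Q hQ ξ η hξ, hη0, sign_zero]
  have hQ0 : Q.map a ≠ 0 := by
    intro h0
    obtain ⟨x', hx'⟩ := h.1.exists_samePos' y
    refine hne ?_
    rw [← h.2 Q hQ x y₁ hy₁, ← h.2 Q hQ x' y hx', h0]
    simp
  obtain ⟨d, hd, rfl⟩ := h.exists_fst_eq hQ hQ0 hξ0
  have hdη : η = d.2 := (hξ.eq_iff hd).1 rfl
  have hd' : d ∈ {d ∈ D | ∃ Q ∈ F, Q.map a ≠ 0 ∧ (Q.map a).eval d.1 = 0} := ⟨hd, Q, hQ, hQ0, hξ0⟩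
  have hxη := (hy₁.mono hsub).convex hxy hη
  have hxd : x = d.1 := (hxη.eq_iff hd').2 hdη
  refine hne ?_
  rw [(hy₁.eq_iff hd).1 hxd, (hxy.eq_iff hd').1 hxd]

theorem SameDiagram.mono {E : Set A[X]} (h : SameDiagram a b F) (hE : E ⊆ F) :
    SameDiagram a b E :=
  let ⟨D, hD⟩ := h
  ⟨D, hD.1, fun P hP => hD.2 P (hE hP)⟩

/-- A polynomial can be added to a family that contains its derivative, if its signs at the roots
of the family are those of members of a larger family with the same diagram. -/
theorem SameDiagram.insert {P : A[X]} {E : Set A[X]} (h : SameDiagram a b F) (hE : E ⊆ F)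
    (hder : derivative P ∈ E) (hPa : (P.map a).natDegree ≠ 0) (hPb : (P.map b).natDegree ≠ 0)
    (hrem : ∀ Q ∈ E, Q.map a ≠ 0 → ∀ x, (Q.map a).eval x = 0 →
      ∃ c : A, ∃ S : A[X], ∃ R ∈ F, C c * P = Q * S + R ∧ a c ≠ 0 ∧ sign (a c) = sign (b c)) :
    SameDiagram a b (insert P E) := by
  obtain ⟨D₁, hD₁⟩ := h
  set D := {d ∈ D₁ | ∃ Q ∈ E, Q.map a ≠ 0 ∧ (Q.map a).eval d.1 = 0} with hDdef
  -- After this restriction each matched point is a root of a member of `E`, so the sign of `P`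
  -- there can be read off a remainder in `F`.
  have hD : IsDiagram a b E D := IsDiagram.restrict ⟨hD₁.1, fun P hP => hD₁.2 P (hE hP)⟩
  have hlift : Liftable D (P.map a) (P.map b) :=
    { matching := hD.1
      natDegree_left := hPa
      natDegree_right := hPb
      sign_eq := by
        rintro d ⟨hd, Q, hQ, hQ0, hQd⟩
        have hQd' : (Q.map b).eval d.2 = 0 := by
          rw [← sign_eq_zero_iff, ← hD₁.2 Q (hE hQ) d.1 d.2 (hD₁.1.samePos d hd), hQd, sign_zero]
        obtain ⟨c, S, R, hR, e, hc, hs⟩ := hrem Q hQ hQ0 d.1 hQd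
        have h₁ : a c * (P.map a).eval d.1 = (R.map a).eval d.1 := by
          have := congrArg (fun T => (T.map a).eval d.1) e
          simpa [hQd] using this
        have h₂ : b c * (P.map b).eval d.2 = (R.map b).eval d.2 := by
          have := congrArg (fun T => (T.map b).eval d.2) e
          simpa [hQd'] using this
        have h₃ := hD₁.2 R hR d.1 d.2 (hD₁.1.samePos d hd)
        rw [← h₁, ← h₂, sign_mul, sign_mul, ← hs] at h₃
        have hs0 : sign (a c) ≠ 0 := by rwa [Ne, sign_eq_zero_iff]
        revert h₃ hs0
        generalize sign (a c) = s
        generalize sign ((P.map a).eval d.1) = s₁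
        generalize sign ((P.map b).eval d.2) = s₂
        revert s s₁ s₂
        decide
      sign_derivative := fun x y hxy => by
        simpa [derivative_map] using hD.2 _ hder x y hxy
      zero_derivative := fun x hx => by
        rw [derivative_map] at hx
        refine hD.exists_fst_eq hder (fun h0 => hPa ?_) hx
        rw [← derivative_map] at h0
        exact derivative_eq_zero.1 h0 }
  refine ⟨Liftable.rootExtension D (P.map a) (P.map b), hlift.isMatching_rootExtension, ?_⟩
  rintro Q (rfl | hQ) x y hxy
  · exact hlift.sign_eq_of_samePos hxy
  · exact hD.2 Q hQ x y (hxy.mono Set.subset_union_left)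

/-- Whether some root of `Q` lies above every root of `P` can be read off the sign diagram. -/
theorem SameDiagram.exists_root_ge (h : SameDiagram a b F) {P Q : A[X]} (hP : P ∈ F) (hQ : Q ∈ F)
    (ha : ∀ x, (P.map a).eval x = 0 → ∃ y, (Q.map a).eval y = 0 ∧ x ≤ y) :
    ∀ x, (P.map b).eval x = 0 → ∃ y, (Q.map b).eval y = 0 ∧ x ≤ y := by
  obtain ⟨D, hD⟩ := h
  intro x' hx'
  obtain ⟨x, hx⟩ := hD.1.exists_samePos' x'
  obtain ⟨y, hy, hxy⟩ := ha x (by rw [← sign_eq_zero_iff, hD.2 P hP x x' hx, hx', sign_zero])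
  -- If `y` lies in the cell of `x`, then `x'` itself is a root of the second polynomial; otherwise
  -- the order of distinct cells carries over.
  by_cases hcell : SamePos D y x'
  · exact ⟨x', by rw [← sign_eq_zero_iff, ← hD.2 Q hQ y x' hcell, hy, sign_zero], le_rfl⟩
  obtain ⟨y', hy'⟩ := hD.1.exists_samePos y
  refine ⟨y', by rw [← sign_eq_zero_iff, ← hD.2 Q hQ y y' hy', hy, sign_zero], ?_⟩
  by_contra hlt
  refine hcell fun d hd => ?_
  have := hx d hd
  have := hy' d hd
  grind

/-- Leading terms are cancelled by cross-multiplication, at the price of one factor `Q.leadingCoeff`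
each time. Nothing is inverted, so the identity survives every specialization. -/
theorem exists_pseudoRemainder (P Q : A[X]) (hQ : Q.natDegree ≠ 0) :
    ∃ (k : ℕ) (S R : A[X]), C (Q.leadingCoeff ^ k) * P = Q * S + R ∧
      R.natDegree < Q.natDegree := by
  induction hn : P.natDegree using Nat.strong_induction_on generalizing P with
  | _ n ih =>
    by_cases hlt : P.natDegree < Q.natDegree
    · exact ⟨0, 0, P, by simp, hlt⟩
    have hle : Q.natDegree ≤ P.natDegree := not_lt.1 hlt
    obtain ⟨k, S, R, e, hR⟩ := ih _ (hn ▸ natDegree_cancelLeads_lt_of_natDegree_le_natDegree hle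
      (by omega)) (Q.cancelLeads P) rfl
    refine ⟨k + 1, C (Q.leadingCoeff ^ k) * (C P.leadingCoeff * X ^ (P.natDegree - Q.natDegree))
      + S, R, ?_, hR⟩
    rw [cancelLeads, Nat.sub_eq_zero_of_le hle, pow_zero, mul_one] at e
    rw [pow_succ, C_mul]
    linear_combination e

theorem map_eraseLead_of_map_leadingCoeff_eq_zero {P : A[X]} (h : a P.leadingCoeff = 0) :
    P.eraseLead.map a = P.map a := by
  conv_rhs => rw [← P.eraseLead_add_monomial_natDegree_leadingCoeff, Polynomial.map_add,
    map_monomial, h, monomial_zero_right, add_zero]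

theorem isDershowitzMannaLT_of_forall_lt {X Y : Multiset ℕ} {n : ℕ} (h : ∀ y ∈ Y, y < n) :
    Multiset.IsDershowitzMannaLT (X + Y) (n ::ₘ X) :=
  ⟨X, Y, {n}, by simp, rfl, by rw [← Multiset.singleton_add, add_comm],
    fun y hy => ⟨n, by simp, h y hy⟩⟩

/-- **Elimination of one real variable.** The sign diagram of a finite family of polynomials is
determined by the signs of finitely many elements of the ring of coefficients. -/
theorem exists_finite_sameDiagram (F : Multiset A[X]) :
    ∃ G : Set A, G.Finite ∧ ∀ a b : A →+* ℝ, (∀ g ∈ G, sign (a g) = sign (b g)) →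
      SameDiagram a b {P | P ∈ F} := by
  induction hM : F.map natDegree using
    (Multiset.wellFounded_isDershowitzMannaLT (α := ℕ)).induction generalizing F with
  | _ M ih =>
  subst hM
  by_cases hconst : ∀ P ∈ F, P.natDegree = 0
  · refine ⟨(fun P : A[X] => P.coeff 0) '' {P | P ∈ F}, F.finite_toSet.image _,
      fun a b hab => ⟨∅, ⟨Set.finite_empty, by simp⟩, fun P hP x y _ => ?_⟩⟩
    have e := eq_C_of_natDegree_eq_zero (hconst P hP)
    have := hab _ ⟨P, hP, rfl⟩
    rw [e]
    simpa using this
  push Not at hconst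
  obtain ⟨P, hP, hmax⟩ := Set.exists_max_image {P | P ∈ F} natDegree F.finite_toSet
    (hconst.imp fun P hP => hP.1)
  have hP0 : P.natDegree ≠ 0 := by
    obtain ⟨Q, hQ, hQ0⟩ := hconst
    have := hmax Q hQ
    omega
  -- Where a leading coefficient vanishes under both specializations, dropping it changes neither of
  -- them and lowers a degree.
  have herase (Q : A[X]) (hQ : Q ∈ F ∧ Q.natDegree ≠ 0) : ∃ G : Set A, G.Finite ∧
      ∀ a b : A →+* ℝ, (∀ g ∈ G, sign (a g) = sign (b g)) →
        a Q.leadingCoeff = 0 → b Q.leadingCoeff = 0 → SameDiagram a b {P | P ∈ F} := by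
    obtain ⟨E, rfl⟩ := Multiset.exists_cons_of_mem hQ.1
    obtain ⟨G, hG, hG'⟩ := ih ((E + {Q.eraseLead}).map natDegree) (by
      rw [Multiset.map_add, Multiset.map_cons]
      refine isDershowitzMannaLT_of_forall_lt ?_
      have := Q.eraseLead_natDegree_le
      simp only [Multiset.map_singleton, Multiset.mem_singleton, forall_eq]
      have := hQ.2
      omega) _ rfl
    refine ⟨G, hG, fun a b hab ha hb => ?_⟩
    obtain ⟨D, hD, hD'⟩ := hG' a b hab
    refine ⟨D, hD, fun R hR => ?_⟩
    rcases Multiset.mem_cons.1 hR with rfl | hR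
    · have := hD' R.eraseLead (by simp)
      rwa [map_eraseLead_of_map_leadingCoeff_eq_zero ha,
        map_eraseLead_of_map_leadingCoeff_eq_zero hb] at this
    · exact hD' R (by simp [hR])
  -- Otherwise a member `P` of maximal degree is traded for its derivative and its
  -- pseudo-remainders, all of smaller degree, and is put back by `SameDiagram.insert`.
  have hdivide : ∃ G : Set A, G.Finite ∧
      ∀ a b : A →+* ℝ, (∀ g ∈ G, sign (a g) = sign (b g)) →
        (∀ Q ∈ F, Q.natDegree ≠ 0 → a Q.leadingCoeff ≠ 0) →
        (∀ Q ∈ F, sign (a Q.leadingCoeff) = sign (b Q.leadingCoeff)) →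
          SameDiagram a b {P | P ∈ F} := by
    have hrem (Q : A[X]) (hQ : Q.natDegree ≤ P.natDegree) : ∃ R : A[X],
        R.natDegree < P.natDegree ∧ (Q.natDegree ≠ 0 → ∃ (k : ℕ) (S : A[X]),
          C (Q.leadingCoeff ^ k) * P = Q * S + R) := by
      by_cases hQ0 : Q.natDegree = 0
      -- A dummy remainder: a constant that is nonzero after specialization has no roots, so no
      -- identity is needed for it.
      · exact ⟨0, by simpa using Nat.pos_of_ne_zero hP0, fun h => absurd hQ0 h⟩
      · obtain ⟨k, S, R, e, hR⟩ := exists_pseudoRemainder P Q hQ0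
        exact ⟨R, hR.trans_le hQ, fun _ => ⟨k, S, e⟩⟩
    choose! rem hrem hrem' using hrem
    obtain ⟨E, rfl⟩ := Multiset.exists_cons_of_mem hP
    have hdeg : ∀ Q ∈ derivative P ::ₘ E, Q.natDegree ≤ P.natDegree := by
      intro Q hQ
      rcases Multiset.mem_cons.1 hQ with rfl | hQ
      · exact (natDegree_derivative_lt hP0).le
      · exact hmax Q (Multiset.mem_cons_of_mem hQ)
    obtain ⟨G, hG, hG'⟩ := ih
        ((E + (derivative P ::ₘ (derivative P ::ₘ E).map rem)).map natDegree) (by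
      rw [Multiset.map_add, Multiset.map_cons natDegree P]
      refine isDershowitzMannaLT_of_forall_lt fun y hy => ?_
      obtain ⟨R, hR, rfl⟩ := Multiset.mem_map.1 hy
      rcases Multiset.mem_cons.1 hR with rfl | hR
      · exact natDegree_derivative_lt hP0
      · obtain ⟨Q, hQ, rfl⟩ := Multiset.mem_map.1 hR
        exact hrem Q (hdeg Q hQ)) _ rfl
    refine ⟨G, hG, fun a b hab hne hs => ?_⟩
    have hPa : a P.leadingCoeff ≠ 0 := hne P hP hP0
    have hPb : b P.leadingCoeff ≠ 0 := by
      rwa [← sign_ne_zero, ← hs P hP, sign_ne_zero]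
    -- The ring `A` may have torsion; that the expected leading coefficient is nonzero is seen from
    -- its image under `a`.
    have hder : (derivative P).leadingCoeff = P.leadingCoeff * P.natDegree := by
      have hc : (derivative P).coeff (P.natDegree - 1) = P.leadingCoeff * P.natDegree := by
        rw [coeff_derivative, Nat.sub_add_cancel (Nat.pos_of_ne_zero hP0), leadingCoeff]
        congr 1
        exact_mod_cast congrArg (Nat.cast : ℕ → A) (Nat.sub_add_cancel (Nat.pos_of_ne_zero hP0))
      have hc0 : (derivative P).coeff (P.natDegree - 1) ≠ 0 := by
        rw [hc]
        intro h0
        have := congrArg a h0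
        rw [map_mul, map_natCast, map_zero, mul_eq_zero] at this
        exact this.elim hPa (by exact_mod_cast hP0)
      rw [← hc, leadingCoeff, le_antisymm (natDegree_derivative_le P)
        (le_natDegree_of_ne_zero hc0)]
    refine ((hG' a b hab).insert (P := P) (E := {Q | Q ∈ derivative P ::ₘ E}) ?_ ?_ ?_ ?_ ?_).mono ?_
    · intro Q hQ
      rcases Multiset.mem_cons.1 hQ with rfl | hQ <;> simp_all
    · exact Multiset.mem_cons_self _ _
    · rwa [natDegree_map_of_leadingCoeff_ne_zero _ hPa]
    · rwa [natDegree_map_of_leadingCoeff_ne_zero _ hPb]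
    · intro Q hQ hQa x hx
      have hQ0 : Q.natDegree ≠ 0 := by
        intro h0
        rw [eq_C_of_natDegree_eq_zero h0] at hx hQa
        simp_all
      have hlc : a Q.leadingCoeff ≠ 0 ∧ sign (a Q.leadingCoeff) = sign (b Q.leadingCoeff) := by
        rcases Multiset.mem_cons.1 hQ with rfl | hQ
        · have hn : (P.natDegree : ℝ) ≠ 0 := by exact_mod_cast hP0
          rw [hder, map_mul a, map_mul b, map_natCast a, map_natCast b, sign_mul, sign_mul, hs P hP]
          exact ⟨mul_ne_zero hPa hn, rfl⟩
        · exact ⟨hne Q (Multiset.mem_cons_of_mem hQ) hQ0, hs Q (Multiset.mem_cons_of_mem hQ)⟩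
      obtain ⟨k, S, e⟩ := hrem' Q (hdeg Q hQ) hQ0
      refine ⟨_, S, rem Q, ?_, e, ?_, ?_⟩
      · exact Multiset.mem_add.2 (Or.inr (Multiset.mem_cons_of_mem (Multiset.mem_map_of_mem _ hQ)))
      · rw [map_pow]
        exact pow_ne_zero _ hlc.1
      · rw [map_pow a, map_pow b, sign_pow, sign_pow, hlc.2]
    · intro Q hQ
      rcases Multiset.mem_cons.1 hQ with rfl | hQ
      · exact Or.inl rfl
      · exact Or.inr (Multiset.mem_cons_of_mem hQ)
  choose! G hG hG' using herase
  obtain ⟨G₁, hG₁, hG₁'⟩ := hdivide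
  refine ⟨leadingCoeff '' {P | P ∈ F} ∪ (⋃ Q ∈ {Q | Q ∈ F ∧ Q.natDegree ≠ 0}, G Q) ∪ G₁, ?_, ?_⟩
  · exact ((F.finite_toSet.image _).union
      ((F.finite_toSet.subset fun Q hQ => hQ.1).biUnion hG)).union hG₁
  intro a b hab
  have hlead : ∀ Q ∈ F, sign (a Q.leadingCoeff) = sign (b Q.leadingCoeff) :=
    fun Q hQ => hab _ (Or.inl (Or.inl ⟨Q, hQ, rfl⟩))
  by_cases hz : ∃ Q ∈ F, Q.natDegree ≠ 0 ∧ a Q.leadingCoeff = 0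
  · obtain ⟨Q, hQ, hQ0, ha⟩ := hz
    refine hG' Q ⟨hQ, hQ0⟩ a b (fun g hg => hab g (Or.inl (Or.inr ?_))) ha ?_
    · exact Set.mem_biUnion (show Q ∈ {Q | Q ∈ F ∧ Q.natDegree ≠ 0} from ⟨hQ, hQ0⟩) hg
    · rw [← sign_eq_zero_iff, ← hlead Q hQ, ha, sign_zero]
  · push Not at hz
    exact hG₁' a b (fun g hg => hab g (Or.inr hg)) hz hlead

end SignDiagram
end InterDelivery

namespace InterDelivery

open SignType

/-! ### Computation trees -/

section Trees

variable {α Ω : Type}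

/-- Some computation tree, started with register contents `ρ · ω`, stops for every `ω ∈ D` after
a bounded number of steps with an output that satisfies `Q ω`. -/
def Solvable (D : Set Ω) {n : ℕ} (ρ : Fin n → Ω → ℝ) (Q : Ω → α → Prop) : Prop :=
  ∃ (t : CompTree α n) (S : ℕ), ∀ ω ∈ D, ∃ a s, t.Run (fun i => ρ i ω) a s ∧ s ≤ S ∧ Q ω a

/-- The function `g` can be computed whenever the functions `ρ₀` are available. -/
def Obtainable {n₀ : ℕ} (ρ₀ : Fin n₀ → Ω → ℝ) (g : Ω → ℝ) : Prop :=
  ∀ (α : Type) (D : Set Ω) (n : ℕ) (ρ : Fin n → Ω → ℝ) (Q : Ω → α → Prop),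
    Set.range ρ₀ ⊆ Set.range ρ →
    (∀ (m : ℕ) (σ : Fin m → Ω → ℝ), Set.range ρ ⊆ Set.range σ → g ∈ Set.range σ →
      Solvable D σ Q) → Solvable D ρ Q

variable {D : Set Ω} {Q : Ω → α → Prop}

theorem Solvable.output {n : ℕ} (ρ : Fin n → Ω → ℝ) (a : α) (h : ∀ ω ∈ D, Q ω a) :
    Solvable D ρ Q :=
  ⟨.output a, 0, fun ω hω => ⟨a, 0, .output _ _, le_rfl, h ω hω⟩⟩

theorem Solvable.compute {n : ℕ} {ρ : Fin n → Ω → ℝ} (c : Instr n)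
    (h : Solvable D (Fin.snoc (α := fun _ => Ω → ℝ) ρ fun ω => c.eval fun i => ρ i ω) Q) :
    Solvable D ρ Q := by
  obtain ⟨t, S, h⟩ := h
  refine ⟨.compute c t, S + 1, fun ω hω => ?_⟩
  obtain ⟨a, s, hrun, hs, hQ⟩ := h ω hω
  refine ⟨a, s + 1, .compute _ _ _ _ _ ?_, Nat.succ_le_succ hs, hQ⟩
  convert hrun using 2 with i
  refine Fin.lastCases ?_ (fun i => ?_) i <;> simp

theorem Solvable.branch {n : ℕ} {ρ : Fin n → Ω → ℝ} (i j : Fin n)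
    (hle : Solvable {ω ∈ D | ρ i ω ≤ ρ j ω} ρ Q) (hgt : Solvable {ω ∈ D | ρ j ω < ρ i ω} ρ Q) :
    Solvable D ρ Q := by
  obtain ⟨t₁, S₁, h₁⟩ := hle
  obtain ⟨t₂, S₂, h₂⟩ := hgt
  refine ⟨.branch i j t₁ t₂, max S₁ S₂ + 1, fun ω hω => ?_⟩
  rcases le_or_gt (ρ i ω) (ρ j ω) with h | h
  · obtain ⟨a, s, hrun, hs, hQ⟩ := h₁ ω ⟨hω, h⟩
    exact ⟨a, s + 1, .branchLe _ _ _ _ _ _ _ h hrun,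
      Nat.succ_le_succ (hs.trans (le_max_left _ _)), hQ⟩
  · obtain ⟨a, s, hrun, hs, hQ⟩ := h₂ ω ⟨hω, h⟩
    exact ⟨a, s + 1, .branchGt _ _ _ _ _ _ _ h hrun,
      Nat.succ_le_succ (hs.trans (le_max_right _ _)), hQ⟩

theorem range_subset_range_snoc {n : ℕ} (ρ : Fin n → Ω → ℝ) (g : Ω → ℝ) :
    Set.range ρ ⊆ Set.range (Fin.snoc (α := fun _ => Ω → ℝ) ρ g : Fin (n + 1) → Ω → ℝ) := by
  rintro _ ⟨i, rfl⟩
  exact ⟨i.castSucc, by simp⟩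

theorem mem_range_snoc {n : ℕ} (ρ : Fin n → Ω → ℝ) (g : Ω → ℝ) :
    g ∈ Set.range (Fin.snoc (α := fun _ => Ω → ℝ) ρ g : Fin (n + 1) → Ω → ℝ) :=
  ⟨Fin.last n, by simp⟩

namespace Obtainable

variable {n₀ : ℕ} {ρ₀ : Fin n₀ → Ω → ℝ} {g g₁ g₂ : Ω → ℝ}

theorem of_mem (h : g ∈ Set.range ρ₀) : Obtainable ρ₀ g := fun _ _ n ρ _ hρ hnext =>
  hnext n ρ le_rfl (hρ h)

theorem const (q : ℚ) : Obtainable ρ₀ fun _ => (q : ℝ) := fun _ _ _ ρ _ _ hnext =>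
  Solvable.compute (.const q) (hnext _ _ (range_subset_range_snoc ρ _) (mem_range_snoc ρ _))

theorem exp (h : Obtainable ρ₀ g) : Obtainable ρ₀ fun ω => Real.exp (g ω) :=
  fun α D n ρ Q hρ hnext => h α D n ρ Q hρ fun m σ hσ ⟨i, hi⟩ =>
    Solvable.compute (.exp i) (hnext _ _ (hσ.trans (range_subset_range_snoc σ _))
      (by rw [← hi]; exact mem_range_snoc σ _))

theorem add (h₁ : Obtainable ρ₀ g₁) (h₂ : Obtainable ρ₀ g₂) :
    Obtainable ρ₀ fun ω => g₁ ω + g₂ ω :=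
  fun α D n ρ Q hρ hnext => h₁ α D n ρ Q hρ fun _ σ hσ hg₁ =>
    h₂ α D _ σ Q (hρ.trans hσ) fun _ σ' hσ' ⟨j, hj⟩ => by
      obtain ⟨i, hi⟩ := hσ' hg₁
      exact Solvable.compute (.add i j) (hnext _ _
        ((hσ.trans hσ').trans (range_subset_range_snoc σ' _))
        (by rw [← hi, ← hj]; exact mem_range_snoc σ' _))

theorem mul (h₁ : Obtainable ρ₀ g₁) (h₂ : Obtainable ρ₀ g₂) :
    Obtainable ρ₀ fun ω => g₁ ω * g₂ ω :=
  fun α D n ρ Q hρ hnext => h₁ α D n ρ Q hρ fun _ σ hσ hg₁ =>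
    h₂ α D _ σ Q (hρ.trans hσ) fun _ σ' hσ' ⟨j, hj⟩ => by
      obtain ⟨i, hi⟩ := hσ' hg₁
      exact Solvable.compute (.mul i j) (hnext _ _
        ((hσ.trans hσ').trans (range_subset_range_snoc σ' _))
        (by rw [← hi, ← hj]; exact mem_range_snoc σ' _))

theorem mvPolynomial {ι : Type*} {v : ι → Ω → ℝ} (hv : ∀ i, Obtainable ρ₀ (v i))
    (P : MvPolynomial ι ℤ) :
    Obtainable ρ₀ fun ω => P.eval₂ (Int.castRingHom ℝ) fun i => v i ω := by
  induction P using MvPolynomial.induction_on with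
  | C c =>
    simp only [MvPolynomial.eval₂_C]
    simpa using const (ρ₀ := ρ₀) (c : ℚ)
  | add P₁ P₂ h₁ h₂ => simpa using h₁.add h₂
  | mul_X P i h => simpa using h.mul (hv i)

end Obtainable

/-- A tree can branch according to the signs of finitely many computable functions. -/
theorem solvable_of_signs {n₀ : ℕ} {ρ₀ : Fin n₀ → Ω → ℝ} {G : Set (Ω → ℝ)} (hG : G.Finite)
    (hobt : ∀ g ∈ G, Obtainable ρ₀ g) (D : Set Ω) (Q : Ω → α → Prop)
    (hQ : ∀ E ⊆ D, (∀ g ∈ G, ∀ ω ∈ E, ∀ ω' ∈ E, sign (g ω) = sign (g ω')) →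
      ∃ a, ∀ ω ∈ E, Q ω a) {n : ℕ} (ρ : Fin n → Ω → ℝ) (hρ : Set.range ρ₀ ⊆ Set.range ρ) :
    Solvable D ρ Q := by
  induction G, hG using Set.Finite.induction_on generalizing D n with
  | empty =>
    obtain ⟨a, ha⟩ := hQ D le_rfl (by simp)
    exact Solvable.output ρ a ha
  | @insert g G _ _ ih =>
    refine hobt g (Set.mem_insert _ _) α D n ρ Q hρ fun m σ hσ hg => ?_
    refine Obtainable.const (ρ₀ := ρ₀) 0 α D m σ Q (hρ.trans hσ) fun k υ hυ ⟨j, hj⟩ => ?_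
    obtain ⟨i, hi⟩ := hυ hg
    have hρυ := (hρ.trans hσ).trans hυ
    have hcase : ∀ s : SignType, Solvable {ω ∈ D | sign (g ω) = s} υ Q := fun s =>
      ih (fun g' hg' => hobt g' (Set.mem_insert_of_mem _ hg')) _ (fun E hE hsign =>
        hQ E (hE.trans (Set.sep_subset _ _)) (by
          rintro g' (rfl | hg') ω hω ω' hω'
          · exact (hE hω).2.trans (hE hω').2.symm
          · exact hsign g' hg' ω hω ω' hω')) υ hρυ
    -- Register `j` holds 0; two comparisons separate the three signs of `g`.
    refine Solvable.branch i j (Solvable.branch j i ?_ ?_) ?_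
    · convert hcase 0 using 1
      ext ω
      simp only [hi, hj, Rat.cast_zero, Set.mem_ofPred_eq, sign_eq_zero_iff]
      grind
    · convert hcase (-1) using 1
      ext ω
      simp only [hi, hj, Rat.cast_zero, Set.mem_ofPred_eq, sign_eq_neg_one_iff]
      grind
    · convert hcase 1 using 1
      ext ω
      simp only [hi, hj, Rat.cast_zero, Set.mem_ofPred_eq, sign_eq_one_iff]

end Trees
end InterDelivery

namespace InterDelivery

open Matrix

/-! ### Positive eigenvectors of nonnegative matrices with a distinguished state -/

section Perron

variable {ι : Type} [Fintype ι]

/-- A positive supersolution of a nonnegative matrix bounds the eigenvalues. -/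
theorem norm_le_of_supersolution {A : Matrix ι ι ℝ} (hA : ∀ x y, 0 ≤ A x y) {h : ι → ℝ}
    (hpos : ∀ x, 0 < h x) {l : ℝ} (hsup : ∀ x, (A *ᵥ h) x ≤ l * h x) {μ : ℂ} {v : ι → ℂ}
    (hv : v ≠ 0) (hμ : (A.map Complex.ofReal) *ᵥ v = μ • v) : ‖μ‖ ≤ l := by
  obtain ⟨x₁, hx₁⟩ := Function.ne_iff.1 hv
  -- The eigenvalue equation is evaluated where the eigenvector is largest relative to `h`.
  obtain ⟨x, -, hx⟩ := Finset.exists_max_image Finset.univ (fun x => ‖v x‖ / h x)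
    ⟨x₁, Finset.mem_univ _⟩
  set m := ‖v x‖ / h x with hm
  have hle (y : ι) : ‖v y‖ ≤ m * h y := by
    have := hx y (Finset.mem_univ y)
    rwa [div_le_iff₀ (hpos y)] at this
  have hmpos : 0 < m := by
    have h₁ := hx x₁ (Finset.mem_univ _)
    have : 0 < ‖v x₁‖ / h x₁ := div_pos (norm_pos_iff.2 hx₁) (hpos x₁)
    linarith
  have hvx : ‖v x‖ = m * h x := by rw [hm, div_mul_cancel₀ _ (hpos x).ne']
  have key : ‖μ‖ * (m * h x) ≤ l * (m * h x) := by
    calc ‖μ‖ * (m * h x) = ‖((A.map Complex.ofReal) *ᵥ v) x‖ := by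
          rw [hμ, Pi.smul_apply, norm_smul, hvx]
      _ ≤ ∑ y, A x y * ‖v y‖ := by
          rw [mulVec, dotProduct]
          refine (norm_sum_le _ _).trans (Finset.sum_le_sum fun y _ => ?_)
          simp [abs_of_nonneg (hA x y)]
      _ ≤ ∑ y, A x y * (m * h y) :=
          Finset.sum_le_sum fun y _ => mul_le_mul_of_nonneg_left (hle y) (hA x y)
      _ = m * (A *ᵥ h) x := by
          rw [mulVec, dotProduct, Finset.mul_sum]
          exact Finset.sum_congr rfl fun y _ => by ring
      _ ≤ m * (l * h x) := mul_le_mul_of_nonneg_left (hsup x) hmpos.le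
      _ = l * (m * h x) := by ring
  exact le_of_mul_le_mul_right key (mul_pos hmpos (hpos x))

variable [DecidableEq ι]

/-- The matrix `L` with column `z` replaced by zero. -/
def taboo (L : Matrix ι ι ℝ) (z : ι) : Matrix ι ι ℝ := .of fun x y => if y = z then 0 else L x y

theorem mulVec_eq_taboo_add (L : Matrix ι ι ℝ) (z : ι) (d : ι → ℝ) (x : ι) :
    (L *ᵥ d) x = (taboo L z *ᵥ d) x + L x z * d z := by
  simp only [mulVec, dotProduct, taboo, of_apply, ite_mul, zero_mul]
  rw [← Finset.sum_erase_add _ _ (Finset.mem_univ z),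
    ← Finset.sum_erase_add (a := z) _ _ (Finset.mem_univ z), if_pos rfl, add_zero]
  congr 1
  exact Finset.sum_congr rfl fun y hy => by rw [if_neg (Finset.ne_of_mem_erase hy)]

/-- The minimum principle for the killed matrix `taboo L z`. -/
def MinPrinciple (L : Matrix ι ι ℝ) (z : ι) : Prop :=
  ∀ (l : ℝ) (d : ι → ℝ), 1 ≤ l → (∀ x, (taboo L z *ᵥ d) x ≤ l * d x) → ∀ x, 0 ≤ d x

/-- The minimum principle applies both to a kernel vector and to its negative. -/
theorem MinPrinciple.det_ne_zero {L : Matrix ι ι ℝ} {z : ι} (h : MinPrinciple L z) {l : ℝ}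
    (hl : 1 ≤ l) : (l • (1 : Matrix ι ι ℝ) - taboo L z).det ≠ 0 := by
  intro h0
  obtain ⟨v, hv, hv0⟩ := exists_mulVec_eq_zero_iff.2 h0
  rw [sub_mulVec, smul_mulVec, one_mulVec, sub_eq_zero] at hv0
  refine hv (funext fun x => le_antisymm ?_ (h l v hl (fun x => ?_) x))
  · have := h l (-v) hl (fun x => by simp [mulVec_neg, ← hv0]) x
    simpa using this
  · rw [← hv0]
    simp

/-- Let `v l` solve `(l - taboo L z) v = L · z`, which is possible for all `l ≥ 1`. It is an
eigenvector of `L` as soon as `v l z = 1`. Comparison with the constant 1 by the minimum principle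
gives `v 1 z ≥ 1` and `v c z ≤ 1`, and `v l z` is continuous in `l`. -/
theorem MinPrinciple.exists_eigenvector {L : Matrix ι ι ℝ} {z : ι} (h : MinPrinciple L z)
    (hL : ∀ x y, 0 ≤ L x y) (h₁ : ∀ x, 1 ≤ (L *ᵥ 1) x) {c : ℝ} (hc : ∀ x, (L *ᵥ 1) x ≤ c) :
    ∃ (l : ℝ) (v : ι → ℝ), 1 ≤ l ∧ (∀ x, 0 ≤ v x) ∧ v z = 1 ∧ L *ᵥ v = l • v := by
  set B : ℝ → Matrix ι ι ℝ := fun l => l • 1 - taboo L z with hB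
  set v : ℝ → ι → ℝ := fun l => (B l)⁻¹ *ᵥ fun x => L x z with hv
  have hv' (l : ℝ) (hl : 1 ≤ l) (x : ι) : l * v l x - (taboo L z *ᵥ v l) x = L x z := by
    have hu : IsUnit (B l).det := (h.det_ne_zero hl).isUnit
    have : B l *ᵥ v l = fun x => L x z := by
      rw [hv, mulVec_mulVec, mul_nonsing_inv _ hu, one_mulVec]
    have := congrFun this x
    simpa [hB, sub_mulVec, smul_mulVec] using this
  have hcont : ContinuousOn (fun l => v l z) (Set.Icc 1 c) := by
    have hBc : Continuous B := by fun_prop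
    have e : ∀ l, v l z = (B l).det⁻¹ * ((B l).adjugate *ᵥ fun x => L x z) z := by
      intro l
      simp [hv, inv_def, smul_mulVec]
    simp only [e]
    refine ContinuousOn.mul (hBc.matrix_det.continuousOn.inv₀ fun l hl => h.det_ne_zero hl.1) ?_
    exact ((continuous_apply z).comp
      (hBc.matrix_adjugate.matrix_mulVec continuous_const)).continuousOn
  have hc1 : 1 ≤ c := (h₁ z).trans (hc z)
  have hlow : 1 ≤ v 1 z := by
    have := h 1 (v 1 - 1) le_rfl (fun x => by
      have e₁ := hv' 1 le_rfl x
      have e₂ := mulVec_eq_taboo_add L z 1 x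
      have := h₁ x
      simp only [mulVec_sub, Pi.sub_apply, Pi.one_apply] at e₂ ⊢
      linarith) z
    simpa using this
  have hup : v c z ≤ 1 := by
    have := h c (1 - v c) hc1 (fun x => by
      have e₁ := hv' c hc1 x
      have e₂ := mulVec_eq_taboo_add L z 1 x
      have := hc x
      simp only [mulVec_sub, Pi.sub_apply, Pi.one_apply] at e₂ ⊢
      linarith) z
    simpa using this
  obtain ⟨l, hl, hlz⟩ := intermediate_value_Icc' hc1 hcont ⟨hup, hlow⟩
  simp only at hlz
  refine ⟨l, v l, hl.1, h l (v l) hl.1 fun x => ?_, hlz, funext fun x => ?_⟩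
  · have := hv' l hl.1 x
    have := hL x z
    linarith
  · have := hv' l hl.1 x
    rw [mulVec_eq_taboo_add L z, hlz, Pi.smul_apply, smul_eq_mul]
    linarith

theorem exists_complex_eigenvector {A : Matrix ι ι ℝ} {μ : ℂ}
    (hμ : μ ∈ spectrum ℂ (A.map Complex.ofReal)) :
    ∃ v : ι → ℂ, v ≠ 0 ∧ (A.map Complex.ofReal) *ᵥ v = μ • v := by
  rw [mem_spectrum_iff_isRoot_charpoly, Polynomial.IsRoot, eval_charpoly] at hμ
  obtain ⟨v, hv, hv0⟩ := exists_mulVec_eq_zero_iff.2 hμ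
  refine ⟨v, hv, ?_⟩
  rw [sub_mulVec, sub_eq_zero] at hv0
  rw [← hv0]
  ext x
  simp [scalar_apply, mulVec_diagonal]

theorem ofReal_mem_spectrum_iff {A : Matrix ι ι ℝ} {l : ℝ} :
    (l : ℂ) ∈ spectrum ℂ (A.map Complex.ofReal) ↔ A.charpoly.eval l = 0 := by
  rw [mem_spectrum_iff_isRoot_charpoly, Polynomial.IsRoot]
  have : (A.map Complex.ofReal).charpoly = A.charpoly.map Complex.ofRealHom :=
    A.charpoly_map Complex.ofRealHom
  rw [this, ← Complex.ofRealHom_eq_coe, Polynomial.eval_map_apply]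
  simp

theorem eval_charpoly_eq_zero_of_eigenvector [Nonempty ι] {A : Matrix ι ι ℝ} {h : ι → ℝ}
    (hpos : ∀ x, 0 < h x) {l : ℝ} (heig : A *ᵥ h = l • h) : A.charpoly.eval l = 0 := by
  rw [eval_charpoly, ← exists_mulVec_eq_zero_iff]
  refine ⟨h, fun h0 => ?_, ?_⟩
  · obtain ⟨x⟩ := ‹Nonempty ι›
    exact (hpos x).ne' (congrFun h0 x)
  · rw [sub_mulVec, heig, sub_eq_zero]
    ext x
    simp [scalar_apply, mulVec_diagonal]

theorem specRadius_eq_of_eigenvector [Nonempty ι] {A : Matrix ι ι ℝ} (hA : ∀ x y, 0 ≤ A x y)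
    {h : ι → ℝ} (hpos : ∀ x, 0 < h x) {l : ℝ} (heig : A *ᵥ h = l • h) (hl : 0 ≤ l) : specRadius A = l := by
  have : spectralRadius ℂ (A.map Complex.ofReal) = ENNReal.ofReal l := by
    refine le_antisymm (iSup₂_le fun μ hμ => ?_) ?_
    · obtain ⟨v, hv, hv'⟩ := exists_complex_eigenvector hμ
      have := norm_le_of_supersolution hA hpos (fun x => (congrFun heig x).le) hv hv'
      rw [← ENNReal.ofReal_coe_nnreal, coe_nnnorm]
      exact ENNReal.ofReal_le_ofReal this
    · have hmem : (l : ℂ) ∈ spectrum ℂ (A.map Complex.ofReal) :=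
        ofReal_mem_spectrum_iff.2 (eval_charpoly_eq_zero_of_eigenvector hpos heig)
      refine le_trans (le_of_eq ?_) (le_iSup₂ (f := fun k (_ : k ∈ _) => (‖k‖₊ : ENNReal)) _ hmem)
      rw [← ENNReal.ofReal_coe_nnreal, coe_nnnorm, Complex.norm_real, Real.norm_of_nonneg hl]
  rw [specRadius, this, ENNReal.toReal_ofReal hl]

theorem le_of_eval_charpoly_eq_zero {A : Matrix ι ι ℝ} (hA : ∀ x y, 0 ≤ A x y)
    {h : ι → ℝ} (hpos : ∀ x, 0 < h x) {l : ℝ} (heig : A *ᵥ h = l • h) {μ : ℝ} (hμ : A.charpoly.eval μ = 0) : μ ≤ l := by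
  obtain ⟨v, hv, hv'⟩ := exists_complex_eigenvector (ofReal_mem_spectrum_iff.2 hμ)
  have := norm_le_of_supersolution hA hpos (fun x => (congrFun heig x).le) hv hv'
  rw [Complex.norm_real] at this
  exact (le_abs_self μ).trans this

end Perron

end InterDelivery

namespace InterDelivery

open Matrix

/-! ### The hitting time of the state in which every client is due -/

section Chain

variable {N : ℕ} {τ : Fin N → ℕ} {p : Fin N → ℝ} {θ : ℝ}

theorem sum_transProb_mul (p : Fin N → ℝ) (u : Fin N) (x : State τ) (g : State τ → ℝ) :
    ∑ y, transProb p u x y * g y = p u * g (successState u x) + (1 - p u) * g (failState x) := by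
  simp [transProb, add_mul, Finset.sum_add_distrib]

theorem transProb_nonneg (hp : ∀ n, 0 < p n ∧ p n < 1) (u : Fin N) (x y : State τ) :
    0 ≤ transProb p u x y := by
  have := hp u
  rw [transProb]
  refine add_nonneg ?_ ?_ <;> split_ifs <;> linarith

theorem slotCost_nonneg (x : State τ) : 0 ≤ slotCost x :=
  Finset.sum_nonneg fun n _ => by split_ifs <;> norm_num

theorem slotCost_le (x : State τ) : slotCost x ≤ N := by
  refine (Finset.sum_le_sum fun n _ => ?_ : slotCost x ≤ ∑ _n : Fin N, (1 : ℝ)).trans ?_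
  · split_ifs <;> norm_num
  · simp

/-- The state in which every client is due. -/
def dueState (τ : Fin N → ℕ) : State τ := fun n => Fin.last (τ n)

/-- The number of successive failures that lead to `dueState`. -/
def slack (x : State τ) : ℕ := Finset.univ.sup fun n => τ n - (x n).val

theorem slack_le (x : State τ) : slack x ≤ tauMax τ :=
  Finset.sup_mono_fun fun _ _ => Nat.sub_le _ _

theorem slack_eq_zero_iff {x : State τ} : slack x = 0 ↔ x = dueState τ := by
  rw [slack, ← Nat.bot_eq_zero, Finset.sup_eq_bot_iff]
  constructor
  · intro h
    funext n
    have := h n (Finset.mem_univ n)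
    have h' := (x n).isLt
    apply Fin.ext
    simp only [Nat.bot_eq_zero] at this
    simp only [dueState, Fin.val_last]
    omega
  · rintro rfl n -
    simp [dueState]

theorem slack_failState_le (x : State τ) : slack (failState x) ≤ slack x - 1 := by
  refine Finset.sup_le fun n _ => ?_
  have : τ n - (x n).val ≤ slack x := Finset.le_sup (f := fun n => τ n - (x n).val)
    (Finset.mem_univ n)
  simp only [failState, tick]
  omega

theorem le_pMax (p : Fin N → ℝ) (u : Fin N) : p u ≤ pMax p :=
  le_ciSup (Set.finite_range p).bddAbove u

theorem pMax_lt_one (hN : 0 < N) (hp : ∀ n, 0 < p n ∧ p n < 1) : pMax p < 1 := by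
  have : Nonempty (Fin N) := ⟨⟨0, hN⟩⟩
  obtain ⟨n, hn⟩ := exists_eq_ciSup_of_finite (f := p)
  rw [pMax, ← hn]
  exact (hp n).2

theorem pMax_pos (hN : 0 < N) (hp : ∀ n, 0 < p n ∧ p n < 1) : 0 < pMax p :=
  (hp ⟨0, hN⟩).1.trans_le (le_pMax p _)

/-- The expected hitting time of `0` from `k`, for a chain that goes down by one with probability `q`
and is reset to `m` otherwise. -/
noncomputable def waitingTime (q : ℝ) (m k : ℕ) : ℝ := (∑ i ∈ Finset.range k, q ^ i) / q ^ m

theorem waitingTime_mono {q : ℝ} (hq : 0 < q) (m : ℕ) {k k' : ℕ} (h : k ≤ k') :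
    waitingTime q m k ≤ waitingTime q m k' := by
  refine div_le_div_of_nonneg_right ?_ (pow_nonneg hq.le m)
  exact Finset.sum_le_sum_of_subset_of_nonneg (Finset.range_mono h)
    fun i _ _ => pow_nonneg hq.le i

theorem waitingTime_pos {q : ℝ} (hq : 0 < q) (m : ℕ) {k : ℕ} (hk : k ≠ 0) :
    0 < waitingTime q m k :=
  div_pos (Finset.sum_pos (fun i _ => pow_pos hq i) (Finset.nonempty_range_iff.2 hk))
    (pow_pos hq m)

theorem waitingTime_succ {q : ℝ} (hq : 0 < q) (m k : ℕ) :
    (1 - q) * waitingTime q m m + q * waitingTime q m k + 1 = waitingTime q m (k + 1) := by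
  have hqm : q ^ m ≠ 0 := (pow_pos hq m).ne'
  have h₁ : (1 - q) * ∑ i ∈ Finset.range m, q ^ i = 1 - q ^ m := mul_neg_geom_sum q m
  have h₂ : ∑ i ∈ Finset.range (k + 1), q ^ i = q * (∑ i ∈ Finset.range k, q ^ i) + 1 :=
    geom_sum_succ
  simp only [waitingTime]
  rw [h₂]
  field_simp
  linear_combination h₁

theorem waitingTime_le_hitBound (hN : 0 < N) (hp : ∀ n, 0 < p n ∧ p n < 1) (x : State τ) :
    waitingTime (1 - pMax p) (tauMax τ) (slack x) ≤ hitBound τ p := by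
  have hq : 0 < 1 - pMax p := sub_pos.2 (pMax_lt_one hN hp)
  have hq1 : 1 - pMax p ≤ 1 := by linarith [pMax_pos hN hp]
  refine (waitingTime_mono hq _ (slack_le x)).trans (le_trans ?_ (Nat.le_ceil _))
  rw [waitingTime, div_eq_mul_inv]
  refine mul_le_mul_of_nonneg_right ?_ (inv_nonneg.2 (pow_nonneg hq.le _))
  refine (Finset.sum_le_sum fun i _ => pow_le_one₀ hq.le hq1).trans ?_
  simp

/-- The worst case is a chain whose resets go all the way to `tauMax τ` and have probability `pMax
p`: since a reset leaves at least as long a wait as a failure does, raising `p u` to `pMax p` only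
increases the bound. For that chain `waitingTime_succ` is an equality. -/
theorem drift (hN : 0 < N) (hp : ∀ n, 0 < p n ∧ p n < 1) (u : Fin N) {x : State τ}
    (hx : x ≠ dueState τ) :
    ∑ y, transProb p u x y * waitingTime (1 - pMax p) (tauMax τ) (slack y) ≤
      waitingTime (1 - pMax p) (tauMax τ) (slack x) - 1 := by
  have hq : 0 < 1 - pMax p := sub_pos.2 (pMax_lt_one hN hp)
  have hx0 : slack x ≠ 0 := fun h => hx (slack_eq_zero_iff.1 h)
  rw [sum_transProb_mul]
  set w := waitingTime (1 - pMax p) (tauMax τ) with hw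
  have h₁ : w (slack (successState u x)) ≤ w (tauMax τ) := waitingTime_mono hq _ (slack_le _)
  have h₂ : w (slack (failState x)) ≤ w (slack x - 1) :=
    waitingTime_mono hq _ (slack_failState_le x)
  have h₃ : w (slack x - 1) ≤ w (tauMax τ) :=
    waitingTime_mono hq _ ((Nat.sub_le _ _).trans (slack_le x))
  have h₄ := waitingTime_succ hq (tauMax τ) (slack x - 1)
  rw [Nat.sub_add_cancel (Nat.pos_of_ne_zero hx0), ← hw] at h₄
  have hu := hp u
  have hum := le_pMax p u
  nlinarith [mul_le_mul_of_nonneg_left h₁ hu.1.le,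
    mul_le_mul_of_nonneg_left h₂ (sub_pos.2 hu.2).le,
    mul_nonneg (sub_nonneg.2 hum) (sub_nonneg.2 h₃)]

/-- Since `Real.log 0 = 0`, the threshold is 0 when `hitBound τ p = 0`. Admissibility thus excludes
the case where all `τ n` vanish. -/
theorem Admissible.hitBound_pos (h : Admissible τ p θ) : 0 < hitBound τ p := by
  rcases Nat.eq_zero_or_pos (hitBound τ p) with h0 | h0
  · have := h.2.1.trans h.2.2
    simp [thetaTh, h0] at this
  · exact h0

/-- This amounts to `θ * N < ln ((K + 1) / K)`; the factor `2 (K + 1)` in the threshold is room to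
spare. -/
theorem Admissible.exp_lt (hN : 0 < N) (h : Admissible τ p θ) :
    Real.exp (θ * N) * hitBound τ p < hitBound τ p + 1 := by
  have hK : (1 : ℝ) ≤ hitBound τ p := by exact_mod_cast h.hitBound_pos
  have hN' : (1 : ℝ) ≤ N := by exact_mod_cast hN
  have hθ := h.2.2
  rw [thetaTh, lt_div_iff₀ (by positivity)] at hθ
  have hlt : θ * N < Real.log (((hitBound τ p : ℝ) + 1) / hitBound τ p) := by
    rw [Real.log_div (by positivity) (by positivity)]
    have : 0 < θ * N := mul_pos h.2.1 (by positivity)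
    nlinarith
  rw [← lt_div_iff₀ (by positivity)]
  exact (Real.lt_log_iff_exp_lt (by positivity)).1 hlt

theorem disutility_nonneg (hp : ∀ n, 0 < p n ∧ p n < 1) (f : State τ → Fin N) (x y : State τ) :
    0 ≤ disutility p θ f x y :=
  mul_nonneg (Real.exp_pos _).le (transProb_nonneg hp _ _ _)

theorem disutility_mulVec (p : Fin N → ℝ) (θ : ℝ) (f : State τ → Fin N) (g : State τ → ℝ)
    (x : State τ) : (disutility p θ f *ᵥ g) x =
      Real.exp (θ * slotCost x) * ∑ y, transProb p (f x) x y * g y := by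
  simp [disutility, mulVec, dotProduct, Finset.mul_sum, mul_assoc]

theorem one_le_exp_slotCost (hθ : 0 < θ) (x : State τ) : 1 ≤ Real.exp (θ * slotCost x) :=
  Real.one_le_exp (mul_nonneg hθ.le (slotCost_nonneg x))

theorem exp_slotCost_le (hθ : 0 < θ) (x : State τ) :
    Real.exp (θ * slotCost x) ≤ Real.exp (θ * N) :=
  Real.exp_le_exp.2 (mul_le_mul_of_nonneg_left (slotCost_le x) hθ.le)

/-- Off `z`, take `x` with least ratio `m = d x / w x`. If `m < 0`, then `m * (taboo w) x ≤ (taboo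
d) x ≤ l * m * w x ≤ m * w x`, contradicting the strict inequality `(taboo w) x < w x`. The value at
`z` is then controlled by the values off `z`. -/
theorem Admissible.minPrinciple (hN : 0 < N) (h : Admissible τ p θ) (f : State τ → Fin N) :
    MinPrinciple (disutility p θ f) (dueState τ) := by
  intro l d hl hd
  have hq : 0 < 1 - pMax p := sub_pos.2 (pMax_lt_one hN h.1)
  set w : State τ → ℝ := fun x => waitingTime (1 - pMax p) (tauMax τ) (slack x) with hw
  have hwpos {x : State τ} (hx : x ≠ dueState τ) : 0 < w x :=
    waitingTime_pos hq _ fun h0 => hx (slack_eq_zero_iff.1 h0)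
  have hwdue : w (dueState τ) = 0 := by
    simp [hw, slack_eq_zero_iff.2 rfl, waitingTime]
  have htaboo (x y : State τ) : 0 ≤ taboo (disutility p θ f) (dueState τ) x y := by
    simp only [taboo, of_apply]
    split_ifs
    · exact le_rfl
    · exact disutility_nonneg h.1 f x y
  have hoff : ∀ x, x ≠ dueState τ → 0 ≤ d x := by
    by_contra! hneg
    obtain ⟨x₁, hx₁, hdx₁⟩ := hneg
    obtain ⟨x, hx, hmin⟩ := Set.exists_min_image {x | x ≠ dueState τ} (fun x => d x / w x)
      (Set.toFinite _) ⟨x₁, hx₁⟩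
    set m := d x / w x with hm
    have hmneg : m < 0 := (hmin x₁ hx₁).trans_lt (div_neg_of_neg_of_pos hdx₁ (hwpos hx₁))
    have hdx : d x = m * w x := by rw [hm, div_mul_cancel₀ _ (hwpos hx).ne']
    have hlow : m * (taboo (disutility p θ f) (dueState τ) *ᵥ w) x ≤
        (taboo (disutility p θ f) (dueState τ) *ᵥ d) x := by
      simp only [mulVec, dotProduct, Finset.mul_sum]
      refine Finset.sum_le_sum fun y _ => ?_
      by_cases hy : y = dueState τ
      · simp [taboo, hy]
      · have := hmin y hy
        rw [le_div_iff₀ (hwpos hy)] at this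
        nlinarith [mul_le_mul_of_nonneg_left this (htaboo x y)]
    have hW : (taboo (disutility p θ f) (dueState τ) *ᵥ w) x < w x := by
      have e := mulVec_eq_taboo_add (disutility p θ f) (dueState τ) w x
      rw [hwdue, mul_zero, add_zero, disutility_mulVec] at e
      rw [← e]
      have hdrift := drift hN h.1 (f x) hx
      have hnn : 0 ≤ ∑ y, transProb p (f x) x y * w y := Finset.sum_nonneg fun y _ =>
        mul_nonneg (transProb_nonneg h.1 _ _ _) (by
          by_cases hy : y = dueState τ
          · rw [hy, hwdue]
          · exact (hwpos hy).le)
      have hexp := (exp_slotCost_le h.2.1 x)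
      have hK := waitingTime_le_hitBound hN h.1 x
      have hK1 : (1 : ℝ) ≤ hitBound τ p := by exact_mod_cast h.hitBound_pos
      have hlt := h.exp_lt hN
      set E := Real.exp (θ * N)
      have hE : 0 < E := Real.exp_pos _
      have h₁ : Real.exp (θ * slotCost x) * ∑ y, transProb p (f x) x y * w y ≤ E * (w x - 1) :=
        mul_le_mul hexp hdrift hnn hE.le
      refine h₁.trans_lt ?_
      change w x ≤ _ at hK
      have hw1 : 0 ≤ w x - 1 := hnn.trans hdrift
      nlinarith
    have := hd x
    nlinarith [hwpos hx, mul_pos (neg_pos.2 hmneg) (hwpos hx)]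
  intro x
  by_cases hx : x = dueState τ
  · subst hx
    have h₀ : 0 ≤ (taboo (disutility p θ f) (dueState τ) *ᵥ d) (dueState τ) :=
      Finset.sum_nonneg fun y _ => by
        by_cases hy : y = dueState τ
        · simp [taboo, hy]
        · exact mul_nonneg (htaboo _ _) (hoff y hy)
    have := h₀.trans (hd (dueState τ))
    exact nonneg_of_mul_nonneg_right this (by linarith)
  · exact hoff x hx

/-- The disutility matrix of a stationary policy has a positive eigenvector. -/
theorem Admissible.exists_eigenvector (hN : 0 < N) (h : Admissible τ p θ) (f : State τ → Fin N) :
    ∃ (l : ℝ) (v : State τ → ℝ), 1 ≤ l ∧ (∀ x, 0 < v x) ∧ v (dueState τ) = 1 ∧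
      disutility p θ f *ᵥ v = l • v := by
  have hsum (x : State τ) : (disutility p θ f *ᵥ 1) x = Real.exp (θ * slotCost x) := by
    rw [disutility_mulVec, sum_transProb_mul]
    simp
  obtain ⟨l, v, hl, hv, hz, e⟩ := (h.minPrinciple hN f).exists_eigenvector
    (disutility_nonneg h.1 f) (fun x => by rw [hsum]; exact one_le_exp_slotCost h.2.1 x)
    (c := Real.exp (θ * N)) (fun x => by rw [hsum]; exact exp_slotCost_le h.2.1 x)
  refine ⟨l, v, hl, fun x => ?_, hz, e⟩
  -- Positivity spreads from `z` backwards along the path of successive failures.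
  induction hk : slack x using Nat.strong_induction_on generalizing x with
  | _ k ih =>
    by_cases hx : x = dueState τ
    · rw [hx, hz]
      exact one_pos
    have hk0 : slack x ≠ 0 := fun h0 => hx (slack_eq_zero_iff.1 h0)
    have hfail := ih (slack (failState x)) (by have := slack_failState_le x; omega) _ rfl
    have ex := congrFun e x
    rw [disutility_mulVec, sum_transProb_mul, Pi.smul_apply, smul_eq_mul] at ex
    have hp := h.1 (f x)
    have : 0 < l * v x := by
      rw [← ex]
      refine mul_pos (Real.exp_pos _) (add_pos_of_nonneg_of_pos (mul_nonneg hp.1.le (hv _)) ?_)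
      exact mul_pos (sub_pos.2 hp.2) hfail
    exact (mul_pos_iff_of_pos_left (by linarith)).1 this

end Chain

end InterDelivery

namespace InterDelivery

open Matrix Filter

/-! ### Finite-horizon costs -/

section Horizon

variable {N : ℕ} {τ : Fin N → ℕ} {p : Fin N → ℝ} {θ : ℝ}

/-- `Y(T)` along the history `h` of length `T` that starts in `x`. -/
def lastState {T : ℕ} (x : State τ) (h : History τ T) : State τ :=
  if hT : T = 0 then x else (h ⟨T - 1, Nat.sub_one_lt hT⟩).2

/-- The finite-horizon cost with terminal reward `g (Y(T))`. -/
noncomputable def terminalCost (p : Fin N → ℝ) (θ : ℝ) (π : Policy τ) (T : ℕ) (x : State τ)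
    (g : State τ → ℝ) : ℝ :=
  ∑ h : History τ T, historyProb p π x h * Real.exp (θ * ∑ t : Fin T, slotCost (stateAt x h t)) *
    g (lastState x h)

theorem horizonCost_eq_terminalCost (π : Policy τ) (T : ℕ) (x : State τ) :
    horizonCost p θ π T x = terminalCost p θ π T x 1 := by
  simp [horizonCost, terminalCost]

theorem terminalCost_zero (π : Policy τ) (x : State τ) (g : State τ → ℝ) :
    terminalCost p θ π 0 x g = g x := by
  simp [terminalCost, historyProb, lastState]

theorem stateAt_snoc_castSucc {T : ℕ} (x : State τ) (h : History τ T) (e : Fin N × State τ)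
    (t : Fin T) :
    stateAt x (Fin.snoc (α := fun _ => Fin N × State τ) h e : History τ (T + 1)) t.castSucc =
      stateAt x h t := by
  simp only [stateAt, Fin.val_castSucc]
  split_ifs with h0
  · rfl
  · have : (⟨t.val - 1, (Nat.sub_le _ _).trans_lt t.castSucc.isLt⟩ : Fin (T + 1)) =
        Fin.castSucc ⟨t.val - 1, (Nat.sub_le _ _).trans_lt t.isLt⟩ := rfl
    rw [this, Fin.snoc_castSucc]

theorem stateAt_snoc_last {T : ℕ} (x : State τ) (h : History τ T) (e : Fin N × State τ) :
    stateAt x (Fin.snoc (α := fun _ => Fin N × State τ) h e : History τ (T + 1)) (Fin.last T) =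
      lastState x h := by
  simp only [stateAt, lastState, Fin.val_last]
  split_ifs with h0
  · rfl
  · have : (⟨T - 1, (Nat.sub_le _ _).trans_lt (Fin.last T).isLt⟩ : Fin (T + 1)) =
        Fin.castSucc ⟨T - 1, Nat.sub_one_lt h0⟩ := rfl
    rw [this, Fin.snoc_castSucc]

theorem lastState_snoc {T : ℕ} (x : State τ) (h : History τ T) (e : Fin N × State τ) :
    lastState x (Fin.snoc (α := fun _ => Fin N × State τ) h e : History τ (T + 1)) = e.2 := by
  have : (⟨T + 1 - 1, Nat.sub_one_lt (Nat.succ_ne_zero T)⟩ : Fin (T + 1)) = Fin.last T := rfl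
  rw [lastState, dif_neg (Nat.succ_ne_zero T), this, Fin.snoc_last]

theorem truncate_snoc_castSucc {T : ℕ} (h : History τ T) (e : Fin N × State τ) (t : Fin T) :
    truncate (Fin.snoc (α := fun _ => Fin N × State τ) h e : History τ (T + 1)) t.castSucc =
      truncate h t := by
  funext s
  exact Fin.snoc_castSucc (α := fun _ => Fin N × State τ) e h ⟨s.val, s.isLt.trans t.isLt⟩

theorem truncate_snoc_last {T : ℕ} (h : History τ T) (e : Fin N × State τ) :
    truncate (Fin.snoc (α := fun _ => Fin N × State τ) h e : History τ (T + 1)) (Fin.last T) =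
      h := by
  funext s
  exact Fin.snoc_castSucc (α := fun _ => Fin N × State τ) e h s

theorem terminalCost_succ (π : Policy τ) (T : ℕ) (x : State τ) (g : State τ → ℝ) :
    terminalCost p θ π (T + 1) x g = ∑ h : History τ T,
      historyProb p π x h * Real.exp (θ * ∑ t : Fin T, slotCost (stateAt x h t)) *
        ∑ u, π.prob T x h u * (Real.exp (θ * slotCost (lastState x h)) *
          ∑ y, transProb p u (lastState x h) y * g y) := by
  rw [terminalCost, ← (Fin.snocEquiv fun _ => Fin N × State τ).sum_comp, Fintype.sum_prod_type,
    Finset.sum_comm]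
  refine Finset.sum_congr rfl fun h _ => ?_
  rw [Fintype.sum_prod_type, Finset.mul_sum]
  refine Finset.sum_congr rfl fun u _ => ?_
  simp only [Finset.mul_sum]
  refine Finset.sum_congr rfl fun y _ => ?_
  have hs : (Fin.snocEquiv fun _ => Fin N × State τ) ((u, y), h) =
    (Fin.snoc (α := fun _ => Fin N × State τ) h (u, y) : History τ (T + 1)) := rfl
  rw [hs, lastState_snoc, historyProb, Fin.prod_univ_castSucc, Fin.sum_univ_castSucc,
    stateAt_snoc_last, truncate_snoc_last]
  simp only [stateAt_snoc_castSucc, truncate_snoc_castSucc, Fin.snoc_castSucc, Fin.snoc_last,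
    Fin.val_castSucc, Fin.val_last]
  rw [Real.exp_add, historyProb]
  ring

theorem historyProb_nonneg (hp : ∀ n, 0 < p n ∧ p n < 1) (π : Policy τ) (x : State τ) {T : ℕ}
    (h : History τ T) : 0 ≤ historyProb p π x h :=
  Finset.prod_nonneg fun _ _ => mul_nonneg (π.prob_nonneg _ _ _ _) (transProb_nonneg hp _ _ _)

theorem terminalCost_mono (hp : ∀ n, 0 < p n ∧ p n < 1) (π : Policy τ) (T : ℕ) (x : State τ)
    {g g' : State τ → ℝ} (hg : ∀ x, g x ≤ g' x) :
    terminalCost p θ π T x g ≤ terminalCost p θ π T x g' :=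
  Finset.sum_le_sum fun h _ => mul_le_mul_of_nonneg_left (hg _)
    (mul_nonneg (historyProb_nonneg hp π x h) (Real.exp_pos _).le)

theorem terminalCost_smul (π : Policy τ) (T : ℕ) (x : State τ) (c : ℝ) (g : State τ → ℝ) :
    terminalCost p θ π T x (c • g) = c * terminalCost p θ π T x g := by
  simp only [terminalCost, Finset.mul_sum, Pi.smul_apply, smul_eq_mul]
  exact Finset.sum_congr rfl fun h _ => by ring

/-- The one-slot inequality holds for every control, so averaging over a randomized choice that
depends on the whole history preserves it. -/
theorem pow_mul_le_terminalCost (hp : ∀ n, 0 < p n ∧ p n < 1) (π : Policy τ) {g : State τ → ℝ}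
    {l : ℝ} (hl : 0 ≤ l)
    (hg : ∀ x u, l * g x ≤ Real.exp (θ * slotCost x) * ∑ y, transProb p u x y * g y)
    (T : ℕ) (x : State τ) : l ^ T * g x ≤ terminalCost p θ π T x g := by
  induction T with
  | zero => simp [terminalCost_zero]
  | succ T ih =>
    calc l ^ (T + 1) * g x = l * (l ^ T * g x) := by ring
      _ ≤ l * terminalCost p θ π T x g := mul_le_mul_of_nonneg_left ih hl
      _ ≤ terminalCost p θ π (T + 1) x g := by
        rw [terminalCost_succ, terminalCost, Finset.mul_sum]
        refine Finset.sum_le_sum fun h _ => ?_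
        rw [mul_left_comm]
        refine mul_le_mul_of_nonneg_left ?_
          (mul_nonneg (historyProb_nonneg hp π x h) (Real.exp_pos _).le)
        calc l * g (lastState x h) = ∑ u, π.prob T x h u * (l * g (lastState x h)) := by
              rw [← Finset.sum_mul, π.prob_sum, one_mul]
          _ ≤ _ := Finset.sum_le_sum fun u _ =>
              mul_le_mul_of_nonneg_left (hg _ u) (π.prob_nonneg _ _ _ _)

theorem terminalCost_le_pow_mul (hp : ∀ n, 0 < p n ∧ p n < 1) (π : Policy τ) {g : State τ → ℝ}
    {l : ℝ} (hl : 0 ≤ l)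
    (hg : ∀ x u, Real.exp (θ * slotCost x) * ∑ y, transProb p u x y * g y ≤ l * g x)
    (T : ℕ) (x : State τ) : terminalCost p θ π T x g ≤ l ^ T * g x := by
  -- The lower bound needs no sign condition on `g`, so it may be applied to `-g`.
  have := pow_mul_le_terminalCost (θ := θ) hp π (g := (-1 : ℝ) • g) hl (fun x u => by
    have := hg x u
    simp only [Pi.smul_apply, smul_eq_mul, neg_mul, one_mul, mul_neg, Finset.sum_neg_distrib]
    linarith) T x
  rw [terminalCost_smul] at this
  simp only [Pi.smul_apply, smul_eq_mul] at this
  linarith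

theorem terminalCost_stationary (f : State τ → Fin N) {g : State τ → ℝ} {l : ℝ}
    (hg : disutility p θ f *ᵥ g = l • g) (T : ℕ) (x : State τ) :
    terminalCost p θ (stationary f) T x g = l ^ T * g x := by
  induction T with
  | zero => simp [terminalCost_zero]
  | succ T ih =>
    rw [pow_succ', mul_assoc, ← ih, terminalCost_succ, terminalCost, Finset.mul_sum]
    refine Finset.sum_congr rfl fun h _ => ?_
    rw [mul_left_comm]
    congr 1
    have e := congrFun hg (lastState x h)
    rw [disutility_mulVec, Pi.smul_apply, smul_eq_mul] at e
    rw [← e]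
    have : ∀ u, (stationary f).prob T x h u = if u = f (lastState x h) then 1 else 0 :=
      fun _ => rfl
    simp [this]

theorem exists_pos_bounds {g : State τ → ℝ} (hg : ∀ x, 0 < g x) :
    ∃ c C : ℝ, 0 < c ∧ 0 < C ∧ ∀ x, c ≤ g x ∧ g x ≤ C := by
  obtain ⟨x₁, h₁⟩ := Finite.exists_min g
  obtain ⟨x₂, h₂⟩ := Finite.exists_max g
  exact ⟨g x₁, g x₂, hg _, hg _, fun x => ⟨h₁ x, h₂ x⟩⟩

/-! ### Average costs -/

theorem tendsto_log_rate {l c : ℝ} (hl : 0 < l) (hc : 0 < c) (θ : ℝ) :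
    Tendsto (fun T : ℕ => 1 / θ * (1 / (T : ℝ)) * Real.log (l ^ T * c)) atTop
      (nhds (1 / θ * Real.log l)) := by
  have h₁ : Tendsto (fun T : ℕ => 1 / θ * (Real.log l + Real.log c / T)) atTop
      (nhds (1 / θ * (Real.log l + 0))) :=
    (tendsto_const_nhds.add (tendsto_const_div_atTop_nhds_zero_nat _)).const_mul _
  rw [add_zero] at h₁
  refine h₁.congr' ?_
  filter_upwards [eventually_gt_atTop 0] with T hT
  have : (T : ℝ) ≠ 0 := by exact_mod_cast hT.ne'
  rw [Real.log_mul (pow_pos hl T).ne' hc.ne', Real.log_pow]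
  field_simp

theorem rate_mono (hθ : 0 < θ) (T : ℕ) {a b : ℝ} (ha : 0 < a) (hab : a ≤ b) :
    1 / θ * (1 / (T : ℝ)) * Real.log a ≤ 1 / θ * (1 / (T : ℝ)) * Real.log b :=
  mul_le_mul_of_nonneg_left (Real.log_le_log ha hab) (by positivity)

/-- With terminal reward `g` the cost is exactly `l ^ T * g x`. The constant reward lies between two
positive multiples of `g`, whose factors disappear in the limit. -/
theorem averageCost_stationary (hp : ∀ n, 0 < p n ∧ p n < 1) (hθ : 0 < θ) (f : State τ → Fin N)
    {g : State τ → ℝ} (hpos : ∀ x, 0 < g x) {l : ℝ} (hl : 0 < l)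
    (hg : disutility p θ f *ᵥ g = l • g) (x : State τ) :
    averageCost p θ (stationary f) x = 1 / θ * Real.log l := by
  obtain ⟨c, C, hc, hC, hb⟩ := exists_pos_bounds hpos
  have hlow (T : ℕ) : l ^ T * (g x / C) ≤ horizonCost p θ (stationary f) T x := by
    have h₁ := terminalCost_mono (θ := θ) hp (stationary f) T x (g := g) (g' := C • 1)
      (fun x => by simpa using (hb x).2)
    rw [terminalCost_stationary f hg, terminalCost_smul, ← horizonCost_eq_terminalCost] at h₁
    rw [← mul_div_assoc, div_le_iff₀ hC]
    linarith
  have hup (T : ℕ) : horizonCost p θ (stationary f) T x ≤ l ^ T * (g x / c) := by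
    have h₁ := terminalCost_mono (θ := θ) hp (stationary f) T x (g := c • 1) (g' := g)
      (fun x => by simpa using (hb x).1)
    rw [terminalCost_stationary f hg, terminalCost_smul, ← horizonCost_eq_terminalCost] at h₁
    rw [← mul_div_assoc, le_div_iff₀ hc]
    linarith
  have hpow (T : ℕ) : 0 < l ^ T * (g x / C) := mul_pos (pow_pos hl T) (div_pos (hpos x) hC)
  refine Tendsto.limsup_eq (tendsto_of_tendsto_of_tendsto_of_le_of_le
    (tendsto_log_rate hl (div_pos (hpos x) hC) θ) (tendsto_log_rate hl (div_pos (hpos x) hc) θ)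
    (fun T => rate_mono hθ T (hpow T) (hlow T))
    fun T => rate_mono hθ T ((hpow T).trans_le (hlow T)) (hup T))

theorem le_averageCost (hp : ∀ n, 0 < p n ∧ p n < 1) (hθ : 0 < θ) {g : State τ → ℝ}
    (hpos : ∀ x, 0 < g x) {l : ℝ} (hl : 0 < l)
    (hg : ∀ x u, l * g x ≤ Real.exp (θ * slotCost x) * ∑ y, transProb p u x y * g y)
    (π : Policy τ) (x : State τ) : 1 / θ * Real.log l ≤ averageCost p θ π x := by
  obtain ⟨c, C, hc, hC, hb⟩ := exists_pos_bounds hpos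
  have hlow (T : ℕ) : l ^ T * (g x / C) ≤ horizonCost p θ π T x := by
    have h₁ := terminalCost_mono (θ := θ) hp π T x (g := g) (g' := C • 1)
      (fun x => by simpa using (hb x).2)
    rw [terminalCost_smul, ← horizonCost_eq_terminalCost] at h₁
    have h₂ := pow_mul_le_terminalCost hp π hl.le hg T x
    rw [← mul_div_assoc, div_le_iff₀ hC]
    linarith
  -- The upper bound only ensures that the real `limsup` is taken over a bounded sequence, as its
  -- monotonicity requires.
  have hup (T : ℕ) : horizonCost p θ π T x ≤ Real.exp (θ * N) ^ T * 1 := by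
    rw [horizonCost_eq_terminalCost]
    refine terminalCost_le_pow_mul hp π (Real.exp_pos _).le (fun x u => ?_) T x
    rw [sum_transProb_mul]
    simpa using exp_slotCost_le hθ x
  have hpow (T : ℕ) : 0 < l ^ T * (g x / C) := mul_pos (pow_pos hl T) (div_pos (hpos x) hC)
  have htend := tendsto_log_rate hl (div_pos (hpos x) hC) θ
  rw [← htend.limsup_eq]
  refine limsup_le_limsup (Eventually.of_forall fun T => rate_mono hθ T (hpow T) (hlow T))
    htend.isCoboundedUnder_le ?_
  exact (tendsto_log_rate (Real.exp_pos (θ * N)) one_pos θ).isBoundedUnder_le.mono_le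
    (Eventually.of_forall fun T => rate_mono hθ T ((hpow T).trans_le (hlow T)) (hup T))

end Horizon

/-! ### Optimal stationary policies -/

section Optimal

variable {N : ℕ} {τ : Fin N → ℕ} {p : Fin N → ℝ} {θ : ℝ}

theorem Admissible.averageCost_eq (hN : 0 < N) (h : Admissible τ p θ) (f : State τ → Fin N)
    (x : State τ) : averageCost p θ (stationary f) x =
      1 / θ * Real.log (specRadius (disutility p θ f)) := by
  obtain ⟨l, v, hl, hv, -, e⟩ := h.exists_eigenvector hN f
  have : Nonempty (State τ) := ⟨x⟩
  rw [specRadius_eq_of_eigenvector (disutility_nonneg h.1 f) hv e (by linarith)]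
  exact averageCost_stationary h.1 h.2.1 f hv (by linarith) e x

/-- The multiplicative optimality equation is solved by the eigenvector of a policy that minimizes
first the eigenvalue and then the eigenvector. -/
theorem Admissible.exists_isOptimal (hN : 0 < N) (h : Admissible τ p θ) :
    ∃ f : State τ → Fin N, IsOptimal p θ f := by
  have : Nonempty (Fin N) := ⟨⟨0, hN⟩⟩
  choose l v hl hv hz e using h.exists_eigenvector hN
  obtain ⟨f, hf⟩ := Finite.exists_min fun f => toLex (l f, ∑ x, v f x)
  have hf₁ (g : State τ → Fin N) : l f ≤ l g := by
    have := hf g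
    rw [Prod.Lex.toLex_le_toLex] at this
    rcases this with h' | h'
    · exact h'.le
    · exact h'.1.le
  have hf₂ (g : State τ → Fin N) (hg : l g = l f) : ∑ x, v f x ≤ ∑ x, v g x := by
    have := hf g
    rw [Prod.Lex.toLex_le_toLex] at this
    rcases this with h' | h'
    · exact absurd hg h'.ne'
    · exact h'.2
  choose g hg using fun x => Finite.exists_min fun u =>
    Real.exp (θ * slotCost x) * ∑ y, transProb p u x y * v f y
  have hsuper (x : State τ) : (disutility p θ g *ᵥ v f) x ≤ l f * v f x := by
    have := congrFun (e f) x
    rw [disutility_mulVec, Pi.smul_apply, smul_eq_mul] at this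
    rw [disutility_mulVec, ← this]
    exact hg x (f x)
  -- The vector `v f` is a positive supersolution for the greedy policy `g`, so it bounds the
  -- eigenvalue `l g`; minimality of `l f` gives the converse.
  have hlg : l g = l f := by
    refine le_antisymm ?_ (hf₁ g)
    have := norm_le_of_supersolution (disutility_nonneg h.1 g) (hv f) hsuper (μ := l g)
      (v := fun x => (v g x : ℂ)) (fun h0 => ?_) (funext fun x => ?_)
    · rw [Complex.norm_real] at this
      exact (le_abs_self _).trans this
    · have := congrFun h0 (dueState τ)
      simp [hz] at this
    · have := congrFun (e g) x
      simp only [mulVec, dotProduct, Pi.smul_apply, smul_eq_mul, map_apply] at this ⊢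
      exact_mod_cast this
  -- Both eigenvectors equal 1 at `z`, so killing at `z` does not affect their difference and the
  -- minimum principle applies.
  have hle (x : State τ) : 0 ≤ (v f - v g) x := by
    refine h.minPrinciple hN g (l f) _ (hl f) (fun x => ?_) x
    have e₁ := mulVec_eq_taboo_add (disutility p θ g) (dueState τ) (v f - v g) x
    have e₂ := congrFun (e g) x
    have e₃ := hsuper x
    simp only [mulVec_sub, Pi.sub_apply, hz, Pi.smul_apply, smul_eq_mul, hlg] at e₁ e₂ ⊢
    linarith
  have heq (x : State τ) : v g x = v f x := by
    have hsum : ∑ x, (v f - v g) x = 0 := by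
      refine le_antisymm ?_ (Finset.sum_nonneg fun x _ => hle x)
      simpa [Finset.sum_sub_distrib] using hf₂ g hlg
    have := (Finset.sum_eq_zero_iff_of_nonneg fun x _ => hle x).1 hsum x (Finset.mem_univ x)
    simp only [Pi.sub_apply] at this
    linarith
  -- As `v g = v f`, the minimum over the controls, attained by `g`, equals `l f * v f x`.
  have hbell (x : State τ) (u : Fin N) :
      l f * v f x ≤ Real.exp (θ * slotCost x) * ∑ y, transProb p u x y * v f y := by
    refine le_trans (le_of_eq ?_) (hg x u)
    have := congrFun (e g) x
    rw [disutility_mulVec, Pi.smul_apply, smul_eq_mul, funext heq, hlg] at this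
    exact this.symm
  have hl0 : 0 < l f := by linarith [hl f]
  refine ⟨f, fun π x => ?_⟩
  rw [averageCost_stationary h.1 h.2.1 f (hv f) hl0 (e f)]
  exact le_averageCost h.1 h.2.1 (hv f) hl0 hbell π x

/-- A stationary policy is optimal if and only if no disutility matrix has a smaller largest
eigenvalue. -/
theorem Admissible.isOptimal_iff (hN : 0 < N) (h : Admissible τ p θ) (f : State τ → Fin N) :
    IsOptimal p θ f ↔ ∀ g : State τ → Fin N, ∀ s, (disutility p θ f).charpoly.eval s = 0 →
      ∃ t, (disutility p θ g).charpoly.eval t = 0 ∧ s ≤ t := by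
  have hne : Nonempty (State τ) := ⟨dueState τ⟩
  -- The eigenvalue of the positive eigenvector is the largest real root. Quantifying over roots
  -- expresses the comparison in a form that a sign diagram detects.
  have hle (f g : State τ → Fin N) :
      (∀ s, (disutility p θ f).charpoly.eval s = 0 →
        ∃ t, (disutility p θ g).charpoly.eval t = 0 ∧ s ≤ t) ↔
      ∀ x, averageCost p θ (stationary f) x ≤ averageCost p θ (stationary g) x := by
    obtain ⟨l, v, hl, hv, -, e⟩ := h.exists_eigenvector hN f
    obtain ⟨l', v', hl', hv', -, e'⟩ := h.exists_eigenvector hN g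
    have hl0 : 0 < l := by linarith
    have hl0' : 0 < l' := by linarith
    have hθ : 0 < 1 / θ := one_div_pos.2 h.2.1
    have hrhs : (∀ x, averageCost p θ (stationary f) x ≤ averageCost p θ (stationary g) x) ↔
        l ≤ l' := by
      simp only [averageCost_stationary h.1 h.2.1 f hv hl0 e,
        averageCost_stationary h.1 h.2.1 g hv' hl0' e', forall_const]
      rw [mul_le_mul_iff_right₀ hθ, Real.log_le_log_iff hl0 hl0']
    rw [hrhs]
    constructor
    · intro hs
      obtain ⟨t, ht, hlt⟩ := hs l (eval_charpoly_eq_zero_of_eigenvector hv e)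
      exact hlt.trans (le_of_eval_charpoly_eq_zero (disutility_nonneg h.1 g) hv' e' ht)
    · intro hll s hs
      exact ⟨l', eval_charpoly_eq_zero_of_eigenvector hv' e',
        (le_of_eval_charpoly_eq_zero (disutility_nonneg h.1 f) hv e hs).trans hll⟩
  simp only [hle]
  constructor
  · exact fun hf g x => hf _ x
  · obtain ⟨g, hg⟩ := h.exists_isOptimal hN
    exact fun hf π x => (hf g x).trans (hg π x)

end Optimal

end InterDelivery

namespace InterDelivery

open Matrix SignType

/-! ### Exact computation of an optimal policy -/

section Computation

variable {N : ℕ} {τ : Fin N → ℕ}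

/-- The disutility matrix with indeterminates in place of `exp θ` and `p`. -/
noncomputable def genericDisutility (f : State τ → Fin N) :
    Matrix (State τ) (State τ) (MvPolynomial (Option (Fin N)) ℤ) :=
  .of fun x y => MvPolynomial.X none ^ (∑ n : Fin N, if (x n).val = τ n then 1 else 0) *
    ((if y = successState (f x) x then MvPolynomial.X (some (f x)) else 0) +
      (if y = failState x then 1 - MvPolynomial.X (some (f x)) else 0))

/-- The values of the indeterminates. -/
noncomputable def parameterValue (o : Option (Fin N)) (ω : (Fin N → ℝ) × ℝ) : ℝ :=
  o.elim (Real.exp ω.2) ω.1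

/-- The specialization of the indeterminates to `exp θ` and `p`. -/
noncomputable def specialize (ω : (Fin N → ℝ) × ℝ) : MvPolynomial (Option (Fin N)) ℤ →+* ℝ :=
  MvPolynomial.eval₂Hom (Int.castRingHom ℝ) fun o => parameterValue o ω

theorem genericDisutility_map (f : State τ → Fin N) (ω : (Fin N → ℝ) × ℝ) :
    (genericDisutility f).map (specialize ω) = disutility ω.1 ω.2 f := by
  ext x y
  have hcost : Real.exp (ω.2 * slotCost x) =
      Real.exp ω.2 ^ (∑ n : Fin N, if (x n).val = τ n then 1 else 0) := by
    rw [← Real.exp_nat_mul, mul_comm, slotCost]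
    push_cast
    rfl
  simp only [genericDisutility, disutility, map_apply, of_apply, map_mul, map_pow, map_add, hcost,
    transProb, apply_ite (specialize ω), map_zero, map_sub, map_one]
  simp [specialize, parameterValue]

theorem charpoly_genericDisutility_map (f : State τ → Fin N) (ω : (Fin N → ℝ) × ℝ) :
    (genericDisutility f).charpoly.map (specialize ω) = (disutility ω.1 ω.2 f).charpoly := by
  rw [← genericDisutility_map]
  exact ((genericDisutility f).charpoly_map (specialize ω)).symm

theorem obtainable_parameterValue (o : Option (Fin N)) :
    Obtainable (fun i (ω : (Fin N → ℝ) × ℝ) => inputData ω.1 ω.2 i) (parameterValue o) := by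
  cases o with
  | none =>
    refine Obtainable.exp (g := Prod.snd) (Obtainable.of_mem ⟨Fin.last N, ?_⟩)
    ext ω
    simp [inputData]
  | some n =>
    refine Obtainable.of_mem ⟨n.castSucc, ?_⟩
    ext ω
    simp [inputData, parameterValue]

/-- On a set of parameters where the finitely many eliminating polynomials have constant signs, the
root comparisons of `Admissible.isOptimal_iff` do not change. A policy that is optimal at one point
of the set is therefore optimal on all of it. -/
theorem exists_compTree (hN : 0 < N) (τ : Fin N → ℕ) :
    ∃ (A : CompTree (State τ → Fin N) (N + 1)) (S : ℕ),
      ∀ (p : Fin N → ℝ) (θ : ℝ), Admissible τ p θ →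
        ∃ (f : State τ → Fin N) (s : ℕ),
          A.Run (inputData p θ) f s ∧ s ≤ S ∧ IsOptimal p θ f := by
  obtain ⟨G, hG, hdiag⟩ := exists_finite_sameDiagram
    (Finset.univ.val.map fun f : State τ → Fin N => (genericDisutility f).charpoly)
  have hmem (f : State τ → Fin N) : (genericDisutility f).charpoly ∈
      {P | P ∈ Finset.univ.val.map fun f : State τ → Fin N => (genericDisutility f).charpoly} :=
    Multiset.mem_map.2 ⟨f, Finset.mem_univ_val f, rfl⟩
  obtain ⟨A, S, hA⟩ := solvable_of_signs (hG.image fun P ω => specialize ω P)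
    (ρ₀ := fun i (ω : (Fin N → ℝ) × ℝ) => inputData ω.1 ω.2 i)
    (by
      rintro _ ⟨P, -, rfl⟩
      exact Obtainable.mvPolynomial obtainable_parameterValue P)
    {ω | Admissible τ ω.1 ω.2} (fun ω (f : State τ → Fin N) => IsOptimal ω.1 ω.2 f)
    (fun E hE hsign => by
      rcases E.eq_empty_or_nonempty with rfl | ⟨ω, hω⟩
      -- A sign pattern that no admissible parameter realizes receives an arbitrary output.
      · exact ⟨fun _ => ⟨0, hN⟩, by simp⟩
      obtain ⟨f, hf⟩ := Admissible.exists_isOptimal hN (hE hω)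
      refine ⟨f, fun ω' hω' => ?_⟩
      rw [Admissible.isOptimal_iff hN (hE hω)] at hf
      rw [Admissible.isOptimal_iff hN (hE hω')]
      intro g
      have hd := hdiag (specialize ω) (specialize ω')
        fun P hP => hsign _ ⟨P, hP, rfl⟩ ω hω ω' hω'
      have := hd.exists_root_ge (hmem f) (hmem g)
      simp only [charpoly_genericDisutility_map] at this
      exact this (hf g))
    (fun i ω => inputData ω.1 ω.2 i) le_rfl
  exact ⟨A, S, fun p θ h => hA (p, θ) h⟩

end Computation

end InterDelivery

theorem theorem2 (N : ℕ) (hN : 0 < N) (τ : Fin N → ℕ) :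
    -- existence of a stationary optimal policy
    (∀ (p : Fin N → ℝ) (θ : ℝ), InterDelivery.Admissible τ p θ →
      ∃ f : InterDelivery.State τ → Fin N, InterDelivery.IsOptimal p θ f) ∧
    -- every stationary policy is evaluated through a spectral radius
    (∀ (p : Fin N → ℝ) (θ : ℝ), InterDelivery.Admissible τ p θ →
      ∀ (f : InterDelivery.State τ → Fin N) (x : InterDelivery.State τ),
        InterDelivery.averageCost p θ (InterDelivery.stationary f) x =
          1 / θ * Real.log (InterDelivery.specRadius (InterDelivery.disutility p θ f))) ∧
    -- a stationary optimal policy is computed from the data in a bounded number of steps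
    (∃ (A : InterDelivery.CompTree (InterDelivery.State τ → Fin N) (N + 1)) (S : ℕ),
      ∀ (p : Fin N → ℝ) (θ : ℝ), InterDelivery.Admissible τ p θ →
        ∃ (f : InterDelivery.State τ → Fin N) (s : ℕ),
          A.Run (InterDelivery.inputData p θ) f s ∧ s ≤ S ∧ InterDelivery.IsOptimal p θ f) := by
  exact ⟨fun p θ h => h.exists_isOptimal hN, fun p θ h => h.averageCost_eq hN,
    InterDelivery.exists_compTree hN τ⟩
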